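/- Let $H$ be an infinite-dimensional separable complex Hilbert space with inner product $\langle\cdot|\cdot\rangle$ linear in the second variable, and let $(x_n)_{n\in\mathbb N}$, $\mathbb N=\{0,1,2,\dots\}$, be an orthonormal basis of $H$. For $\alpha\in\mathbb C$ let $$\psi_\alpha := e^{-|\alpha|^2/2}\sum_{n\in\mathbb N}\frac{\alpha^n}{\sqrt{n!}}\,x_n\in H .$$ Let $L^\infty(\mathbb C)$ be taken with respect to Lebesgue measure $d^2\alpha=d\operatorname{Re}(\alpha)\,d\operatorname{Im}(\alpha)$, let $\mathcal L(H)$ be the algebra of bounded operators on $H$, and define linear maps $\Psi:\mathcal L(H)\to L^\infty(\mathbb C)$ (the Husimi map) and $\Gamma:L^\infty(\mathbb C)\to\mathcal L(H)$ (the quantum-classical channel of the Bargmann measure $\pi^{-1}|\psi_\alpha\rangle\langle\psi_\alpha|\,d^2\alpha$) by $$\Psi(A)(\alpha):=\langle\psi_\alpha|A\psi_\alpha\rangle,\qquad \langle\xi|\Gamma(f)\eta\rangle:=\frac1\pi\int_{\mathbb C}f(\alpha)\,\langle\xi|\psi_\alpha\rangle\langle\psi_\alpha|\eta\rangle\,d^2\alpha\quad(\xi,\eta\in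 H).$$ A channel between unital $C^*$-algebras is a unital completely positive linear map; a channel between von Neumann algebras is normal if it is continuous for the $\sigma$-weak topologies. Let $\mathcal A\otimes\mathcal B$ denote the injective (minimal) $C^*$-tensor product of unital $C^*$-algebras. A state on $\mathcal A\otimes\mathcal B$ is separable if it lies in the weak-$*$ closed convex hull of the product states $\varphi\otimes\psi$, where $\varphi,\psi$ are states on $\mathcal A,\mathcal B$. A channel $\Lambda:\mathcal A\to\mathcal A_{\mathrm{in}}$ is entanglement-breaking (EB) if for every unital $C^*$-algebra $\mathcal B$ and every state $\omega$ on $\mathcal A_{\mathrm{in}}\otimes\mathcal B$, the state $\omega\circ(\Lambda\otimes\mathrm{id}_{\mathcal B})$ on $\mathcal A\otimes\mathcal B$ is separable. **Proposition.** For every von Neumann algebra $\mathcal M$ acting on $H$, the restriction $\Lambda_{\mathcal M}:=(\Gamma\circ\Psi)|_{\mathcal M}:\mathcal M\to\mathcal L(H)$ is a normal channel, it is entanglement-breaking, and it is injective. -/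

import Mathlib

open scoped TensorProduct InnerProductSpace ComplexOrder ENNReal
open MeasureTheory

universe u v w

namespace EBChannel

noncomputable section

section OperatorAlgebras

set_option linter.unusedSectionVars false

variable {H : Type u} [NormedAddCommGroup H] [InnerProductSpace ℂ H] [CompleteSpace H]
variable {K : Type v} [NormedAddCommGroup K] [InnerProductSpace ℂ K] [CompleteSpace K]

/-- A von Neumann algebra is norm closed, being a commutant. -/
instance isClosed_toStarSubalgebra (M : VonNeumannAlgebra H) :
    IsClosed (M.toStarSubalgebra : Set (H →L[ℂ] H)) := by
  have h : (M.toStarSubalgebra : Set (H →L[ℂ] H)) =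
      Set.centralizer (Set.centralizer (M.toStarSubalgebra : Set (H →L[ℂ] H))) :=
    M.centralizer_centralizer'.symm
  rw [h]
  exact Set.isClosed_centralizer _

/-- For the order inherited from the operators on `H`, the positive elements of a concrete
C⋆-algebra are the elements `s⋆ s` with `s` in the algebra. -/
instance starOrderedRing_starSubalgebra (A : StarSubalgebra ℂ (H →L[ℂ] H))
    [IsClosed (A : Set (H →L[ℂ] H))] : StarOrderedRing A := by
  refine StarOrderedRing.of_nonneg_iff' (fun {x y} hxy z => ?_) (fun x => ⟨fun hx => ?_, ?_⟩)
  · exact add_le_add_right (show (x : H →L[ℂ] H) ≤ y from hxy) (z : H →L[ℂ] H)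
  · have hx' : (0 : H →L[ℂ] H) ≤ (x : H →L[ℂ] H) := hx
    have hsa : IsSelfAdjoint x := Subtype.ext (IsSelfAdjoint.of_nonneg hx').star_eq
    have hq : QuasispectrumRestricts x ContinuousMap.realToNNReal := by
      refine SpectrumRestricts.nnreal_iff.mpr fun r hr => ?_
      have h1 : (r : ℂ) ∈ spectrum ℂ x := hsa.coe_mem_spectrum_complex.mpr hr
      rw [StarSubalgebra.spectrum_eq] at h1
      exact spectrum_nonneg_of_nonneg hx'
        ((IsSelfAdjoint.of_nonneg hx').coe_mem_spectrum_complex.mp h1)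
    obtain ⟨s, hs, -, hs2⟩ := CFC.exists_sqrt_of_isSelfAdjoint_of_quasispectrumRestricts hsa hq
    exact ⟨s, by rw [hs.star_eq, hs2]⟩
  · rintro ⟨s, rfl⟩
    exact star_mul_self_nonneg (s : H →L[ℂ] H)

/-- A channel in the Heisenberg picture: a unital completely positive linear map. -/
def IsChannel {A : Type u} {C : Type v} [CStarAlgebra A] [CStarAlgebra C]
    [PartialOrder A] [PartialOrder C] [StarOrderedRing A] [StarOrderedRing C]
    (Λ : A →ₗ[ℂ] C) : Prop :=
  Λ 1 = 1 ∧ ∃ Φ : CompletelyPositiveMap A C, Φ.toLinearMap = Λ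

/-- The `σ`-weak topology on the bounded operators on `H`: the coarsest topology that makes all
functionals `X ↦ ∑ₙ ⟪ξₙ, X ηₙ⟫` with `∑ₙ ‖ξₙ‖² < ∞` and `∑ₙ ‖ηₙ‖² < ∞` continuous. -/
@[reducible] def sigmaWeakTopology (H : Type u) [NormedAddCommGroup H] [InnerProductSpace ℂ H] :
    TopologicalSpace (H →L[ℂ] H) :=
  ⨅ (ξ : ℕ → H) (η : ℕ → H) (_ : Summable fun n => ‖ξ n‖ ^ 2) (_ : Summable fun n => ‖η n‖ ^ 2),
    TopologicalSpace.induced (fun X : H →L[ℂ] H => ∑' n, ⟪ξ n, X (η n)⟫_ℂ) inferInstance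

/-- A linear map from a von Neumann algebra on `H` to the bounded operators on `K` is normal if it
is continuous for the `σ`-weak topologies. -/
def IsNormal (M : VonNeumannAlgebra H) (Λ : M.toStarSubalgebra →ₗ[ℂ] (K →L[ℂ] K)) : Prop :=
  @Continuous _ _
    (TopologicalSpace.induced (fun X : M.toStarSubalgebra => (X : H →L[ℂ] H))
      (sigmaWeakTopology H))
    (sigmaWeakTopology K) Λ

/-- The states on a unital C⋆-algebra, as a subset of the dual with the weak-⋆ topology. -/
def stateSpace (A : Type u) [Ring A] [StarRing A] [Algebra ℂ A] [TopologicalSpace A] :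
    Set (WeakDual ℂ A) :=
  {φ | (∀ a : A, 0 ≤ φ (star a * a)) ∧ φ 1 = 1}

/-- The Hilbert space tensor product: the completion of the algebraic tensor product for the inner
product with `⟪x ⊗ y, x' ⊗ y'⟫ = ⟪x, x'⟫ ⟪y, y'⟫`. -/
def HilbertTensor (H : Type u) (K : Type v) [NormedAddCommGroup H] [InnerProductSpace ℂ H]
    [NormedAddCommGroup K] [InnerProductSpace ℂ K] : Type (max u v) :=
  UniformSpace.Completion (H ⊗[ℂ] K)

instance : NormedAddCommGroup (HilbertTensor H K) :=
  inferInstanceAs (NormedAddCommGroup (UniformSpace.Completion (H ⊗[ℂ] K)))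

instance : InnerProductSpace ℂ (HilbertTensor H K) :=
  inferInstanceAs (InnerProductSpace ℂ (UniformSpace.Completion (H ⊗[ℂ] K)))

instance : CompleteSpace (HilbertTensor H K) :=
  inferInstanceAs (CompleteSpace (UniformSpace.Completion (H ⊗[ℂ] K)))

/-- The vector `ξ ⊗ η` of the Hilbert space tensor product. -/
def vecTensor (ξ : H) (η : K) : HilbertTensor H K :=
  ((ξ ⊗ₜ[ℂ] η : H ⊗[ℂ] K) : UniformSpace.Completion (H ⊗[ℂ] K))

/-- The bounded operator `S ⊗ T` on the Hilbert space tensor product. -/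
def opTensor (S : H →L[ℂ] H) (T : K →L[ℂ] K) : HilbertTensor H K →L[ℂ] HilbertTensor H K :=
  (TensorProduct.mapL S T).completion

theorem opTensor_vecTensor (S : H →L[ℂ] H) (T : K →L[ℂ] K) (ξ : H) (η : K) :
    opTensor S T (vecTensor ξ η) = vecTensor (S ξ) (T η) := by
  change (TensorProduct.mapL S T).completion
    ((ξ ⊗ₜ[ℂ] η : H ⊗[ℂ] K) : UniformSpace.Completion (H ⊗[ℂ] K)) = _
  rw [ContinuousLinearMap.completion_apply_coe, TensorProduct.mapL_tmul]
  rfl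

theorem inner_vecTensor (ξ ξ' : H) (η η' : K) :
    ⟪vecTensor ξ η, vecTensor ξ' η'⟫_ℂ = ⟪ξ, ξ'⟫_ℂ * ⟪η, η'⟫_ℂ := by
  change ⟪((ξ ⊗ₜ[ℂ] η : H ⊗[ℂ] K) : UniformSpace.Completion (H ⊗[ℂ] K)),
    ((ξ' ⊗ₜ[ℂ] η' : H ⊗[ℂ] K) : UniformSpace.Completion (H ⊗[ℂ] K))⟫_ℂ = _
  rw [UniformSpace.Completion.inner_coe, TensorProduct.inner_tmul]

/-- The injective (i.e. minimal, or spatial) C⋆-tensor product of two C⋆-algebras acting on `H`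
and `K`: the norm closure of the algebra generated by the operators `a ⊗ b` on the Hilbert space
tensor product. -/
def injTensor (A : StarSubalgebra ℂ (H →L[ℂ] H)) (B : StarSubalgebra ℂ (K →L[ℂ] K)) :
    StarSubalgebra ℂ (HilbertTensor H K →L[ℂ] HilbertTensor H K) :=
  (StarAlgebra.adjoin ℂ {T | ∃ a ∈ A, ∃ b ∈ B, T = opTensor a b}).topologicalClosure

/-- The elementary tensor `a ⊗ b` as an element of the injective tensor product. -/
def elemTensor (A : StarSubalgebra ℂ (H →L[ℂ] H)) (B : StarSubalgebra ℂ (K →L[ℂ] K))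
    (a : A) (b : B) : injTensor A B :=
  ⟨opTensor (a : H →L[ℂ] H) (b : K →L[ℂ] K),
    StarSubalgebra.le_topologicalClosure _
      (StarAlgebra.subset_adjoin ℂ _ ⟨a, a.2, b, b.2, rfl⟩)⟩

/-- The product states `φ ⊗ ψ` on the injective tensor product. -/
def productStates (A : StarSubalgebra ℂ (H →L[ℂ] H)) (B : StarSubalgebra ℂ (K →L[ℂ] K)) :
    Set (WeakDual ℂ (injTensor A B)) :=
  {χ | χ ∈ stateSpace (injTensor A B) ∧ ∃ φ ∈ stateSpace A, ∃ ψ ∈ stateSpace B,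
    ∀ (a : A) (b : B), χ (elemTensor A B a b) = φ a * ψ b}

/-- The separable states: the weak-⋆ closed convex hull of the product states. -/
def separableStates (A : StarSubalgebra ℂ (H →L[ℂ] H)) (B : StarSubalgebra ℂ (K →L[ℂ] K)) :
    Set (WeakDual ℂ (injTensor A B)) :=
  closure (convexHull ℝ (productStates A B))

/-- A channel `Λ` from a C⋆-algebra `A` acting on `H` to the algebra of all bounded operators on
`K` is entanglement-breaking if for every C⋆-algebra `B` (acting, without loss of generality, on
some Hilbert space `L`) and every state `ω` on the injective tensor product of the operators on
`K` with `B`, the state `ω ∘ (Λ ⊗ id)` on the injective tensor product of `A` and `B` is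
separable. The elementary tensors span a norm dense subspace, so `ω ∘ (Λ ⊗ id)` is the unique
continuous functional `τ` with `τ (a ⊗ b) = ω (Λ a ⊗ b)`. -/
def IsEntanglementBreaking (A : StarSubalgebra ℂ (H →L[ℂ] H)) (Λ : A →ₗ[ℂ] (K →L[ℂ] K)) :
    Prop :=
  ∀ (L : Type w) [NormedAddCommGroup L] [InnerProductSpace ℂ L] [CompleteSpace L]
    (B : StarSubalgebra ℂ (L →L[ℂ] L)), IsClosed (B : Set (L →L[ℂ] L)) →
    ∀ ω ∈ stateSpace (injTensor (⊤ : StarSubalgebra ℂ (K →L[ℂ] K)) B),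
      ∃ τ ∈ separableStates A B, ∀ (a : A) (b : B),
        τ (elemTensor A B a b) = ω (elemTensor ⊤ B ⟨Λ a, StarSubalgebra.mem_top⟩ b)

end OperatorAlgebras

section CoherentStates

set_option linter.unusedSectionVars false

variable {H : Type u} [NormedAddCommGroup H] [InnerProductSpace ℂ H] [CompleteSpace H]

/-- The coefficient `αⁿ / √(n!)`. -/
def cohCoeff (α : ℂ) (n : ℕ) : ℂ := α ^ n / ((√(n.factorial : ℝ) : ℝ) : ℂ)

/-- The coherent state vector `ψ_α = exp (-|α|² / 2) ∑ₙ (αⁿ / √(n!)) xₙ`. -/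
def coherentVec (x : HilbertBasis ℕ ℂ H) (α : ℂ) : H :=
  ((Real.exp (-‖α‖ ^ 2 / 2) : ℝ) : ℂ) • ∑' n, cohCoeff α n • x n

theorem norm_cohCoeff_sq (α : ℂ) (n : ℕ) :
    ‖cohCoeff α n‖ ^ 2 = (‖α‖ ^ 2) ^ n / n.factorial := by
  rw [cohCoeff, norm_div, norm_pow, Complex.norm_real, Real.norm_of_nonneg (Real.sqrt_nonneg _),
    div_pow, Real.sq_sqrt (by positivity), ← pow_mul, ← pow_mul, mul_comm n 2]

theorem norm_cohCoeff_le {α : ℂ} {R : ℝ} (hα : ‖α‖ ≤ R) (n : ℕ) :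
    ‖cohCoeff α n‖ ≤ (2 * R ^ 2) ^ n / n.factorial + (1 / 2) ^ n := by
  have hR : 0 ≤ R := (norm_nonneg α).trans hα
  have h1 : ‖cohCoeff α n‖ ^ 2 ≤ ((2 * R ^ 2) ^ n / n.factorial) * (1 / 2) ^ n := by
    rw [norm_cohCoeff_sq, div_mul_eq_mul_div, ← mul_pow]
    have : 2 * R ^ 2 * (1 / 2) = R ^ 2 := by ring
    rw [this]
    gcongr
  have ha : 0 ≤ (2 * R ^ 2) ^ n / (n.factorial : ℝ) := by positivity
  have hb : (0 : ℝ) ≤ (1 / 2) ^ n := by positivity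
  refine abs_le_of_sq_le_sq' ?_ (add_nonneg ha hb) |>.2
  nlinarith [mul_nonneg ha hb]

theorem summable_bound (R : ℝ) :
    Summable fun n : ℕ => (2 * R ^ 2) ^ n / (n.factorial : ℝ) + (1 / 2 : ℝ) ^ n :=
  (Real.summable_pow_div_factorial _).add summable_geometric_two

theorem norm_basis (x : HilbertBasis ℕ ℂ H) (n : ℕ) : ‖x n‖ = 1 := x.orthonormal.1 n

theorem summable_cohCoeff (x : HilbertBasis ℕ ℂ H) (α : ℂ) :
    Summable fun n => cohCoeff α n • x n := by
  refine Summable.of_norm_bounded (summable_bound ‖α‖) fun n => ?_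
  rw [norm_smul, norm_basis, mul_one]
  exact norm_cohCoeff_le le_rfl n

theorem continuous_coherentVec (x : HilbertBasis ℕ ℂ H) : Continuous (coherentVec x) := by
  refine Continuous.smul (by fun_prop) ?_
  rw [continuous_iff_continuousAt]
  intro α
  have hc : ContinuousOn (fun β : ℂ => ∑' n, cohCoeff β n • x n) (Metric.ball 0 (‖α‖ + 1)) := by
    refine continuousOn_tsum (u := fun n : ℕ => (2 * (‖α‖ + 1) ^ 2) ^ n / (n.factorial : ℝ) +
      (1 / 2 : ℝ) ^ n) (fun n => ?_) (summable_bound _) (fun n β hβ => ?_)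
    · unfold cohCoeff
      fun_prop
    · rw [norm_smul, norm_basis, mul_one]
      exact norm_cohCoeff_le (mem_ball_zero_iff.mp hβ).le n
  exact hc.continuousAt (Metric.isOpen_ball.mem_nhds (by simp))

theorem norm_coherentVec (x : HilbertBasis ℕ ℂ H) (α : ℂ) : ‖coherentVec x α‖ = 1 := by
  have hs := summable_cohCoeff x α
  have hcoef : ∀ n, ⟪x n, ∑' m, cohCoeff α m • x m⟫_ℂ = cohCoeff α n := by
    intro n
    have h1 : ⟪x n, ∑' m, cohCoeff α m • x m⟫_ℂ = ∑' m, ⟪x n, cohCoeff α m • x m⟫_ℂ :=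
      ContinuousLinearMap.map_tsum (innerSL ℂ (x n)) hs
    rw [h1, tsum_eq_single n]
    · rw [inner_smul_right, inner_self_eq_norm_sq_to_K, norm_basis]
      simp
    · intro m hm
      rw [inner_smul_right, x.orthonormal.2 hm.symm, mul_zero]
  have h2 := x.tsum_inner_mul_inner (∑' m, cohCoeff α m • x m) (∑' m, cohCoeff α m • x m)
  have h3 : ‖∑' m, cohCoeff α m • x m‖ ^ 2 = Real.exp (‖α‖ ^ 2) := by
    have h4 : ∀ n, ⟪∑' m, cohCoeff α m • x m, x n⟫_ℂ * ⟪x n, ∑' m, cohCoeff α m • x m⟫_ℂ =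
        (((‖α‖ ^ 2) ^ n / n.factorial : ℝ) : ℂ) := by
      intro n
      rw [← inner_conj_symm, hcoef, mul_comm, Complex.mul_conj, ← norm_cohCoeff_sq,
        Complex.normSq_eq_norm_sq]
    simp_rw [h4] at h2
    rw [← Complex.ofReal_tsum] at h2
    have h6 : Real.exp (‖α‖ ^ 2) = ∑' n : ℕ, (‖α‖ ^ 2) ^ n / (n.factorial : ℝ) := by
      rw [Real.exp_eq_exp_ℝ, NormedSpace.exp_eq_tsum_div]
    rw [h6, ← inner_self_eq_norm_sq (𝕜 := ℂ), ← h2]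
    exact Complex.ofReal_re _
  have h5 : ‖coherentVec x α‖ ^ 2 = 1 := by
    rw [coherentVec, norm_smul, mul_pow, h3, Complex.norm_real,
      Real.norm_of_nonneg (Real.exp_pos _).le, ← Real.exp_nat_mul, ← Real.exp_add]
    have : ((2 : ℕ) : ℝ) * (-‖α‖ ^ 2 / 2) + ‖α‖ ^ 2 = 0 := by push_cast; ring
    rw [this, Real.exp_zero]
  exact (pow_eq_one_iff_of_nonneg (norm_nonneg _) two_ne_zero).mp h5

/-- The function `α ↦ ⟪ψ_α, A ψ_α⟫`. -/
def husimiFun (x : HilbertBasis ℕ ℂ H) (A : H →L[ℂ] H) (α : ℂ) : ℂ :=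
  ⟪coherentVec x α, A (coherentVec x α)⟫_ℂ

theorem memLp_husimiFun (x : HilbertBasis ℕ ℂ H) (A : H →L[ℂ] H) :
    MemLp (husimiFun x A) ∞ (volume : Measure ℂ) := by
  have hc : Continuous (husimiFun x A) :=
    (continuous_coherentVec x).inner (A.continuous.comp (continuous_coherentVec x))
  refine memLp_top_of_bound hc.aestronglyMeasurable ‖A‖ (Filter.Eventually.of_forall fun α => ?_)
  refine (norm_inner_le_norm _ _).trans ?_
  rw [norm_coherentVec, one_mul]
  simpa [norm_coherentVec] using A.le_opNorm (coherentVec x α)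

/-- The Husimi map `Ψ` from the bounded operators on `H` to `L^∞(ℂ)`,
`Ψ(A)(α) = ⟪ψ_α, A ψ_α⟫`. -/
def husimi (x : HilbertBasis ℕ ℂ H) : (H →L[ℂ] H) →ₗ[ℂ] Lp ℂ ∞ (volume : Measure ℂ) where
  toFun A := (memLp_husimiFun x A).toLp _
  map_add' A B := by
    rw [← MemLp.toLp_add]
    congr 1
    ext α
    simp [husimiFun]
  map_smul' c A := by
    rw [RingHom.id_apply, ← MemLp.toLp_const_smul]
    congr 1
    ext α
    simp [husimiFun]

/-- The function `α ↦ exp (-|α|² / 2) conj(α)ⁿ / √(n!)`, i.e. `α ↦ ⟪ψ_α, xₙ⟫`. -/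
def fockFun (n : ℕ) (α : ℂ) : ℂ :=
  ((Real.exp (-‖α‖ ^ 2 / 2) : ℝ) : ℂ) * (starRingEnd ℂ) (cohCoeff α n)

theorem hasSum_inner_coherentVec (x : HilbertBasis ℕ ℂ H) (α : ℂ) (η : H) :
    HasSum (fun n => ⟪x n, η⟫_ℂ * fockFun n α) ⟪coherentVec x α, η⟫_ℂ := by
  have h : HasSum (fun n => ⟪η, cohCoeff α n • x n⟫_ℂ) ⟪η, ∑' n, cohCoeff α n • x n⟫_ℂ :=
    (summable_cohCoeff x α).hasSum.mapL (innerSL ℂ η)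
  have h2 := (h.map (starRingEnd ℂ) Complex.continuous_conj).mul_left
    ((Real.exp (-‖α‖ ^ 2 / 2) : ℝ) : ℂ)
  convert! h2 using 1
  · ext n
    simp only [Function.comp, inner_conj_symm, inner_smul_left, fockFun]
    ring
  · simp only [coherentVec, inner_conj_symm, inner_smul_left, Complex.conj_ofReal]

theorem continuous_fockFun (n : ℕ) : Continuous (fockFun n) := by
  unfold fockFun cohCoeff
  exact Continuous.mul (by fun_prop) (Complex.continuous_conj.comp (by fun_prop))

theorem norm_fockFun_sq (n : ℕ) (α : ℂ) :
    ‖fockFun n α‖ ^ 2 = (n.factorial : ℝ)⁻¹ *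
      (‖α‖ ^ (2 * n : ℝ) * Real.exp (-‖α‖ ^ (2 : ℝ))) := by
  have h1 : ‖α‖ ^ (2 * n : ℝ) = (‖α‖ ^ 2) ^ n := by
    rw [← pow_mul]; exact_mod_cast Real.rpow_natCast ‖α‖ (2 * n)
  have h2 : ‖α‖ ^ (2 : ℝ) = ‖α‖ ^ 2 := by exact_mod_cast Real.rpow_natCast ‖α‖ 2
  rw [h1, h2, fockFun, norm_mul, mul_pow, RCLike.norm_conj, norm_cohCoeff_sq, Complex.norm_real,
    Real.norm_of_nonneg (Real.exp_pos _).le, ← Real.exp_nat_mul]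
  have : ((2 : ℕ) : ℝ) * (-‖α‖ ^ 2 / 2) = -‖α‖ ^ 2 := by push_cast; ring
  rw [this]
  ring

theorem integral_norm_fockFun_sq (n : ℕ) : ∫ α : ℂ, ‖fockFun n α‖ ^ 2 = Real.pi := by
  simp_rw [norm_fockFun_sq]
  rw [integral_const_mul, Complex.integral_rpow_mul_exp_neg_rpow (by norm_num)
    (by have : (0 : ℝ) ≤ n := Nat.cast_nonneg n
        linarith)]
  have : (2 * (n : ℝ) + 2) / 2 = n + 1 := by ring
  rw [this, Real.Gamma_nat_eq_factorial]
  field_simp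

theorem memLp_fockFun (n : ℕ) : MemLp (fockFun n) 2 (volume : Measure ℂ) := by
  rw [memLp_two_iff_integrable_sq_norm (continuous_fockFun n).aestronglyMeasurable]
  by_contra h
  exact Real.pi_ne_zero ((integral_norm_fockFun_sq n).symm.trans (integral_undef h))

theorem integral_fockFun_mul {m n : ℕ} (hmn : m ≠ n) :
    ∫ α : ℂ, fockFun n α * (starRingEnd ℂ) (fockFun m α) = 0 := by
  set I := ∫ α : ℂ, fockFun n α * (starRingEnd ℂ) (fockFun m α) with hI
  have hd : ((m : ℝ) - n) ≠ 0 := sub_ne_zero.mpr (by exact_mod_cast hmn)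
  set c : Circle := Circle.exp (Real.pi / ((m : ℝ) - n)) with hc
  have hrot : ∀ (k : ℕ) (α : ℂ), fockFun k (rotation c α) =
      (starRingEnd ℂ) ((c : ℂ) ^ k) * fockFun k α := by
    intro k α
    rw [fockFun, fockFun, LinearIsometryEquiv.norm_map, rotation_apply, cohCoeff, cohCoeff,
      mul_pow]
    simp only [map_mul, map_div₀]
    ring
  have hcc : (starRingEnd ℂ) ((c : ℂ) ^ n) * (c : ℂ) ^ m = -1 := by
    rw [hc, Circle.coe_exp, ← Complex.exp_nat_mul, ← Complex.exp_nat_mul, ← Complex.exp_conj,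
      ← Complex.exp_add, ← Complex.exp_pi_mul_I]
    congr 1
    have hd' : ((m : ℂ) - n) ≠ 0 := by exact_mod_cast hd
    simp only [map_mul, map_natCast, Complex.conj_ofReal, Complex.conj_I]
    push_cast
    field_simp
    ring
  have h1 : ∫ α : ℂ, fockFun n (rotation c α) * (starRingEnd ℂ) (fockFun m (rotation c α)) = I :=
    (rotation c).measurePreserving.integral_comp (rotation c).toHomeomorph.measurableEmbedding
      (fun α => fockFun n α * (starRingEnd ℂ) (fockFun m α))
  have h2 : ∀ α : ℂ, fockFun n (rotation c α) * (starRingEnd ℂ) (fockFun m (rotation c α)) =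
      -1 * (fockFun n α * (starRingEnd ℂ) (fockFun m α)) := by
    intro α
    rw [hrot, hrot, ← hcc]
    simp only [map_mul, Complex.conj_conj]
    ring
  simp_rw [h2] at h1
  rw [integral_const_mul, ← hI] at h1
  have h3 : 2 * I = 0 := by linear_combination -h1
  simpa using h3

theorem inner_fock (m n : ℕ) :
    ⟪(memLp_fockFun m).toLp _, (memLp_fockFun n).toLp _⟫_ℂ = if m = n then (Real.pi : ℂ) else 0 := by
  have h0 : ⟪(memLp_fockFun m).toLp _, (memLp_fockFun n).toLp _⟫_ℂ =
      ∫ α : ℂ, fockFun n α * (starRingEnd ℂ) (fockFun m α) := by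
    rw [L2.inner_def]
    refine integral_congr_ae ?_
    filter_upwards [(memLp_fockFun m).coeFn_toLp, (memLp_fockFun n).coeFn_toLp] with α h1 h2
    rw [h1, h2, RCLike.inner_apply]
  rw [h0]
  split_ifs with h
  · subst h
    have : ∀ α, fockFun m α * (starRingEnd ℂ) (fockFun m α) = ((‖fockFun m α‖ ^ 2 : ℝ) : ℂ) := by
      intro α
      rw [Complex.mul_conj, Complex.normSq_eq_norm_sq]
    simp_rw [this]
    rw [integral_complex_ofReal, integral_norm_fockFun_sq]
  · exact integral_fockFun_mul h

/-- The functions `α ↦ ⟪ψ_α, η⟫` are square integrable. -/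
theorem eLpNorm_inner_coherentVec_le (x : HilbertBasis ℕ ℂ H) (η : H) :
    eLpNorm (fun α => ⟪coherentVec x α, η⟫_ℂ) 2 (volume : Measure ℂ) ≤
      ENNReal.ofReal (√Real.pi * ‖η‖) := by
  set F : ℕ → Lp ℂ 2 (volume : Measure ℂ) := fun n => (memLp_fockFun n).toLp _ with hF
  set S : ℕ → ℂ → ℂ := fun N α => ∑ n ∈ Finset.range N, ⟪x n, η⟫_ℂ * fockFun n α with hS
  have hbound : ∀ N, eLpNorm (S N) 2 (volume : Measure ℂ) ≤ ENNReal.ofReal (√Real.pi * ‖η‖) := by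
    intro N
    set G : Lp ℂ 2 (volume : Measure ℂ) := ∑ n ∈ Finset.range N, ⟪x n, η⟫_ℂ • F n with hG
    have hGS : G =ᵐ[volume] S N := by
      have h1 : ∀ n, (⟪x n, η⟫_ℂ • F n : Lp ℂ 2 (volume : Measure ℂ)) =ᵐ[volume]
          fun α => ⟪x n, η⟫_ℂ * fockFun n α := by
        intro n
        filter_upwards [Lp.coeFn_smul ⟪x n, η⟫_ℂ (F n), (memLp_fockFun n).coeFn_toLp]
          with α h1 h2
        rw [h1, Pi.smul_apply, h2, smul_eq_mul]
      have h2 := Lp.coeFn_finsetSum (Finset.range N) (fun n => ⟪x n, η⟫_ℂ • F n)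
      filter_upwards [h2, ae_all_iff.mpr h1] with α h3 h4
      rw [hG, h3, Finset.sum_apply]
      exact Finset.sum_congr rfl fun n _ => h4 n
    have hGsq : ‖G‖ ^ 2 ≤ Real.pi * ‖η‖ ^ 2 := by
      have h1 : (⟪G, G⟫_ℂ : ℂ) =
          ((Real.pi * ∑ n ∈ Finset.range N, ‖⟪x n, η⟫_ℂ‖ ^ 2 : ℝ) : ℂ) := by
        rw [hG, sum_inner]
        simp_rw [inner_sum, inner_smul_left, inner_smul_right, hF, inner_fock]
        push_cast
        rw [Finset.mul_sum]
        refine Finset.sum_congr rfl fun n hn => ?_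
        rw [Finset.sum_eq_single n]
        · rw [if_pos rfl, ← Complex.conj_mul']
          ring
        · intro k _ hk
          rw [if_neg hk.symm, mul_zero, mul_zero]
        · exact fun h => absurd hn h
      have h2 : ‖G‖ ^ 2 = Real.pi * ∑ n ∈ Finset.range N, ‖⟪x n, η⟫_ℂ‖ ^ 2 := by
        rw [← inner_self_eq_norm_sq (𝕜 := ℂ), h1]
        exact Complex.ofReal_re _
      rw [h2]
      exact mul_le_mul_of_nonneg_left (x.orthonormal.sum_inner_products_le η) Real.pi_pos.le
    have hGn : ‖G‖ ≤ √Real.pi * ‖η‖ := by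
      refine abs_le_of_sq_le_sq' ?_ (by positivity) |>.2
      rwa [mul_pow, Real.sq_sqrt Real.pi_pos.le]
    rw [← eLpNorm_congr_ae hGS]
    have h3 : eLpNorm G 2 volume = ENNReal.ofReal ‖G‖ := by
      rw [Lp.norm_def, ENNReal.ofReal_toReal (Lp.eLpNorm_ne_top G)]
    rw [h3]
    exact ENNReal.ofReal_le_ofReal hGn
  refine (Lp.eLpNorm_lim_le_liminf_eLpNorm (f := S) (fun N => ?_) _
    (Filter.Eventually.of_forall fun α => (hasSum_inner_coherentVec x α η).tendsto_sum_nat)).trans ?_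
  · refine Continuous.aestronglyMeasurable ?_
    exact continuous_finsetSum _ fun n _ => continuous_const.mul (continuous_fockFun n)
  · exact Filter.liminf_le_of_frequently_le' (Filter.Frequently.of_forall hbound)

theorem memLp_inner_coherentVec (x : HilbertBasis ℕ ℂ H) (η : H) :
    MemLp (fun α => ⟪coherentVec x α, η⟫_ℂ) 2 (volume : Measure ℂ) :=
  ⟨((continuous_coherentVec x).inner continuous_const).aestronglyMeasurable,
    (eLpNorm_inner_coherentVec_le x η).trans_lt ENNReal.ofReal_lt_top⟩

theorem integral_norm_mul_norm_le (x : HilbertBasis ℕ ℂ H) (ξ η : H) :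
    Integrable (fun α => ⟪ξ, coherentVec x α⟫_ℂ * ⟪coherentVec x α, η⟫_ℂ) (volume : Measure ℂ) ∧
      ∫ α : ℂ, ‖⟪ξ, coherentVec x α⟫_ℂ * ⟪coherentVec x α, η⟫_ℂ‖ ≤
        Real.pi * (‖ξ‖ * ‖η‖) := by
  have hconj : ∀ᵐ α ∂(volume : Measure ℂ),
      ‖⟪ξ, coherentVec x α⟫_ℂ‖ₑ = ‖⟪coherentVec x α, ξ⟫_ℂ‖ₑ :=
    Filter.Eventually.of_forall fun α => by
      rw [← ofReal_norm, ← ofReal_norm, norm_inner_symm]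
  have hm1 : AEStronglyMeasurable (fun α => ⟪ξ, coherentVec x α⟫_ℂ) (volume : Measure ℂ) :=
    (continuous_const.inner (continuous_coherentVec x)).aestronglyMeasurable
  have hn1 : eLpNorm (fun α => ⟪ξ, coherentVec x α⟫_ℂ) 2 (volume : Measure ℂ) ≤
      ENNReal.ofReal (√Real.pi * ‖ξ‖) :=
    (eLpNorm_congr_enorm_ae hconj).trans_le (eLpNorm_inner_coherentVec_le x ξ)
  have h1 : eLpNorm (fun α => ⟪ξ, coherentVec x α⟫_ℂ * ⟪coherentVec x α, η⟫_ℂ) 1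
      (volume : Measure ℂ) ≤ ENNReal.ofReal (Real.pi * (‖ξ‖ * ‖η‖)) := by
    have h2 := eLpNorm_smul_le_mul_eLpNorm (p := 2) (q := 2) (r := 1)
      (memLp_inner_coherentVec x η).1 hm1
    refine h2.trans ((mul_le_mul' hn1 (eLpNorm_inner_coherentVec_le x η)).trans_eq ?_)
    rw [← ENNReal.ofReal_mul (by positivity)]
    congr 1
    calc √Real.pi * ‖ξ‖ * (√Real.pi * ‖η‖) = (√Real.pi * √Real.pi) * (‖ξ‖ * ‖η‖) := by ring
      _ = _ := by rw [Real.mul_self_sqrt Real.pi_pos.le]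
  have hm : AEStronglyMeasurable
      (fun α => ⟪ξ, coherentVec x α⟫_ℂ * ⟪coherentVec x α, η⟫_ℂ) (volume : Measure ℂ) :=
    hm1.mul (memLp_inner_coherentVec x η).1
  refine ⟨memLp_one_iff_integrable.mp ⟨hm, h1.trans_lt ENNReal.ofReal_lt_top⟩, ?_⟩
  rw [integral_norm_eq_lintegral_enorm hm, ← eLpNorm_one_eq_lintegral_enorm]
  exact ENNReal.toReal_le_of_le_ofReal (by positivity) h1

theorem ae_norm_le (f : Lp ℂ ∞ (volume : Measure ℂ)) : ∀ᵐ α ∂(volume : Measure ℂ), ‖f α‖ ≤ ‖f‖ := by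
  filter_upwards [enorm_ae_le_eLpNormEssSup f volume] with α h
  rw [Lp.norm_def, ← toReal_enorm]
  refine ENNReal.toReal_mono (Lp.eLpNorm_ne_top f) ?_
  rwa [eLpNorm_exponent_top]

/-- The integrand of the sesquilinear form of the Bargmann channel is integrable. -/
theorem integrable_bargmann (x : HilbertBasis ℕ ℂ H) (f : Lp ℂ ∞ (volume : Measure ℂ))
    (ξ η : H) :
    Integrable (fun α => f α * (⟪ξ, coherentVec x α⟫_ℂ * ⟪coherentVec x α, η⟫_ℂ))
      (volume : Measure ℂ) :=
  (integral_norm_mul_norm_le x ξ η).1.bdd_mul (Lp.aestronglyMeasurable f) (ae_norm_le f)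

theorem norm_integral_bargmann_le (x : HilbertBasis ℕ ℂ H) (f : Lp ℂ ∞ (volume : Measure ℂ))
    (ξ η : H) :
    ‖∫ α : ℂ, f α * (⟪ξ, coherentVec x α⟫_ℂ * ⟪coherentVec x α, η⟫_ℂ)‖ ≤
      ‖f‖ * (Real.pi * (‖ξ‖ * ‖η‖)) := by
  have h := integral_norm_mul_norm_le x ξ η
  calc ‖∫ α : ℂ, f α * (⟪ξ, coherentVec x α⟫_ℂ * ⟪coherentVec x α, η⟫_ℂ)‖
      ≤ ∫ α : ℂ, ‖f‖ * ‖⟪ξ, coherentVec x α⟫_ℂ * ⟪coherentVec x α, η⟫_ℂ‖ := by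
        refine norm_integral_le_of_norm_le (h.1.norm.const_mul _) ?_
        filter_upwards [ae_norm_le f] with α hα
        rw [norm_mul]
        exact mul_le_mul_of_nonneg_right hα (norm_nonneg _)
    _ ≤ _ := by
        rw [integral_const_mul]
        exact mul_le_mul_of_nonneg_left h.2 (norm_nonneg _)

/-- The bounded sesquilinear form `(η, ξ) ↦ conj (π⁻¹ ∫ f(α) ⟪ξ, ψ_α⟫ ⟪ψ_α, η⟫ d²α)`. -/
def bargmannForm (x : HilbertBasis ℕ ℂ H) (f : Lp ℂ ∞ (volume : Measure ℂ)) :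
    H →L⋆[ℂ] H →L[ℂ] ℂ :=
  LinearMap.mkContinuous₂
    (LinearMap.mk₂'ₛₗ (starRingEnd ℂ) (RingHom.id ℂ)
      (fun η ξ => (starRingEnd ℂ) ((Real.pi : ℂ)⁻¹ *
        ∫ α : ℂ, f α * (⟪ξ, coherentVec x α⟫_ℂ * ⟪coherentVec x α, η⟫_ℂ)))
      (by
        intro η₁ η₂ ξ
        simp_rw [inner_add_right, mul_add]
        rw [integral_add (integrable_bargmann x f ξ η₁) (integrable_bargmann x f ξ η₂)]
        simp only [mul_add, map_add])
      (by
        intro c η ξ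
        have h : ∀ α : ℂ, f α * (⟪ξ, coherentVec x α⟫_ℂ * ⟪coherentVec x α, c • η⟫_ℂ) =
            c * (f α * (⟪ξ, coherentVec x α⟫_ℂ * ⟪coherentVec x α, η⟫_ℂ)) := by
          intro α
          rw [inner_smul_right]
          ring
        simp_rw [h]
        rw [integral_const_mul]
        simp only [map_mul, smul_eq_mul]
        ring)
      (by
        intro η ξ₁ ξ₂
        simp_rw [inner_add_left, add_mul, mul_add]
        rw [integral_add (integrable_bargmann x f ξ₁ η) (integrable_bargmann x f ξ₂ η)]
        simp only [mul_add, map_add])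
      (by
        intro c η ξ
        have h : ∀ α : ℂ, f α * (⟪c • ξ, coherentVec x α⟫_ℂ * ⟪coherentVec x α, η⟫_ℂ) =
            (starRingEnd ℂ) c * (f α * (⟪ξ, coherentVec x α⟫_ℂ * ⟪coherentVec x α, η⟫_ℂ)) := by
          intro α
          rw [inner_smul_left]
          ring
        simp_rw [h]
        rw [integral_const_mul]
        simp only [map_mul, smul_eq_mul, Complex.conj_conj, RingHom.id_apply]
        ring))
    ‖f‖
    (by
      intro η ξ
      have h := norm_integral_bargmann_le x f ξ η
      rw [LinearMap.mk₂'ₛₗ_apply, RCLike.norm_conj, norm_mul, norm_inv, Complex.norm_real,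
        Real.norm_of_nonneg Real.pi_pos.le, inv_mul_le_iff₀ Real.pi_pos]
      exact h.trans_eq (by ring))

/-- The Bargmann channel `Γ` from `L^∞(ℂ)` to the bounded operators on `H`,
`Γ(f) = π⁻¹ ∫ f(α) |ψ_α⟩⟨ψ_α| d²α` in the weak sense: `Γ(f)` is the bounded operator with
`⟪ξ, Γ(f) η⟫ = π⁻¹ ∫ f(α) ⟪ξ, ψ_α⟫ ⟪ψ_α, η⟫ d²α`, see `inner_bargmannOp`. -/
def bargmannOp (x : HilbertBasis ℕ ℂ H) (f : Lp ℂ ∞ (volume : Measure ℂ)) : H →L[ℂ] H :=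
  InnerProductSpace.continuousLinearMapOfBilin (bargmannForm x f)

theorem inner_bargmannOp (x : HilbertBasis ℕ ℂ H) (f : Lp ℂ ∞ (volume : Measure ℂ)) (ξ η : H) :
    ⟪ξ, bargmannOp x f η⟫_ℂ = (Real.pi : ℂ)⁻¹ *
      ∫ α : ℂ, f α * (⟪ξ, coherentVec x α⟫_ℂ * ⟪coherentVec x α, η⟫_ℂ) := by
  rw [← inner_conj_symm, bargmannOp, InnerProductSpace.continuousLinearMapOfBilin_apply]
  exact Complex.conj_conj _

/-- The Bargmann channel as a linear map. -/
def bargmann (x : HilbertBasis ℕ ℂ H) : Lp ℂ ∞ (volume : Measure ℂ) →ₗ[ℂ] (H →L[ℂ] H) where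
  toFun f := bargmannOp x f
  map_add' f g := by
    ext η
    refine ext_inner_left ℂ fun ξ => ?_
    rw [_root_.add_apply, inner_add_right]
    simp only [inner_bargmannOp]
    rw [← mul_add, ← integral_add (integrable_bargmann x f ξ η) (integrable_bargmann x g ξ η)]
    congr 1
    refine integral_congr_ae ?_
    filter_upwards [Lp.coeFn_add f g] with α h
    rw [h, Pi.add_apply, add_mul]
  map_smul' c f := by
    ext η
    refine ext_inner_left ℂ fun ξ => ?_
    rw [RingHom.id_apply, _root_.smul_apply, inner_smul_right]
    simp only [inner_bargmannOp]
    rw [mul_left_comm, ← integral_const_mul c]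
    congr 1
    refine integral_congr_ae ?_
    filter_upwards [Lp.coeFn_smul c f] with α h
    rw [h, Pi.smul_apply, smul_eq_mul, mul_assoc]

/-- The restriction to the von Neumann algebra `M` of the composite `Γ ∘ Ψ` of the Husimi map with
the Bargmann channel. -/
def coherentChannel (x : HilbertBasis ℕ ℂ H) (M : VonNeumannAlgebra H) :
    M.toStarSubalgebra →ₗ[ℂ] (H →L[ℂ] H) :=
  (bargmann x ∘ₗ husimi x).comp M.toStarSubalgebra.subtype.toAlgHom.toLinearMap

end CoherentStates

end

end EBChannel

/-! Write ψ_α for the coherent vectors, so that the channel is `Λ(X) = π⁻¹ ∫ ⟪ψ_α, X ψ_α⟫ |ψ_α⟩⟨ψ_α|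
d²α`: measure X against coherent states, then prepare a coherent operator density. Everything starts
from the resolution of the identity `∫ |ψ_α⟩⟨ψ_α| d²α = π` (`integral_inner_coherentVec_mul`), which
gives `Λ(1) = 1` and shows that the ψ_α are total.

Complete positivity: for a matrix `S⋆ S` over the algebra and a tuple h, the quadratic form of `Λ(S⋆
S)` at h is the integral of `∑ₗ ‖∑ⱼ ⟪ψ_α, hⱼ⟫ Sₗⱼ ψ_α‖²`. The passage between the C⋆-order on
matrices and quadratic forms is `nonneg_of_matrixOp`.

Normality: the map `V ξ = (α ↦ ⟪ψ_α, ξ⟫ ψ_α)` into `L²(ℂ) ⊗ H` satisfies `π Λ(X) = V⋆ (1 ⊗ X) V`.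
Expanding in an orthonormal basis of `L²(ℂ)` gives a Kraus decomposition (`hasSum_inner_krausVec`),
so a σ-weak functional composed with Λ is again a square summable sum of vector functionals.

Entanglement breaking: finitely many Husimi functions are uniformly close to step functions on a
common finite partition `Eₙ` with sample points `pₙ`. Hence `Λ(a)` is norm close to `∑ ⟪ψ_{pₙ}, a
ψ_{pₙ}⟫ Γ(1_{Eₙ})`. Since `Γ(1_{Eₙ}) ≥ 0`, the functional `b ↦ ω(Γ(1_{Eₙ}) ⊗ b)` is a nonnegative
multiple of a state, so `ω(Λ(a) ⊗ b)` is approximated by a convex combination of product states.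
Weak-⋆ compactness of the separable states (`exists_separable_of_approx`) yields an exact separable
state.

Injectivity: matrix elements of `Λ(A)` between ψ_{-c} and ψ_c, with c suitably chosen, are Fourier
coefficients of the Husimi function times a Gaussian, so `Λ(A) = 0` forces the Husimi function to
vanish (`husimiFun_eq_zero`). Up to normalization that function is the diagonal of a two-variable
entire function, which is determined by its diagonal (`eq_zero_of_husimiFun_eq_zero`). -/

namespace EBChannel

noncomputable section

/-! ### The Bargmann transform and the resolution of the identity. -/

section BargmannTransform

set_option linter.unusedSectionVars false

variable {H : Type u} [NormedAddCommGroup H] [InnerProductSpace ℂ H] [CompleteSpace H]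

/-- The Bargmann transform `η ↦ (α ↦ ⟪ψ_α, η⟫)` into `L²(ℂ)`. -/
def bargmannTransform (x : HilbertBasis ℕ ℂ H) : H →L[ℂ] Lp ℂ 2 (volume : Measure ℂ) :=
  LinearMap.mkContinuous
    { toFun := fun η => (memLp_inner_coherentVec x η).toLp _
      map_add' := fun η ξ => by
        rw [← MemLp.toLp_add]
        congr 1
        ext α
        simp
      map_smul' := fun c η => by
        rw [RingHom.id_apply, ← MemLp.toLp_const_smul]
        congr 1
        ext α
        simp }
    (√Real.pi) fun η => by
      rw [LinearMap.coe_mk, AddHom.coe_mk, Lp.norm_toLp]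
      exact ENNReal.toReal_le_of_le_ofReal (by positivity) (eLpNorm_inner_coherentVec_le x η)

theorem bargmannTransform_coeFn (x : HilbertBasis ℕ ℂ H) (η : H) :
    bargmannTransform x η =ᵐ[volume] fun α => ⟪coherentVec x α, η⟫_ℂ :=
  (memLp_inner_coherentVec x η).coeFn_toLp

theorem inner_coherentVec_basis (x : HilbertBasis ℕ ℂ H) (α : ℂ) (n : ℕ) :
    ⟪coherentVec x α, x n⟫_ℂ = fockFun n α := by
  refine (hasSum_inner_coherentVec x α (x n)).unique ?_
  convert! hasSum_ite_eq n (fockFun n α) using 1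
  ext m
  rw [orthonormal_iff_ite.mp x.orthonormal]
  split_ifs with h <;> simp [h]

theorem bargmannTransform_basis (x : HilbertBasis ℕ ℂ H) (n : ℕ) :
    bargmannTransform x (x n) = (memLp_fockFun n).toLp _ := by
  change (memLp_inner_coherentVec x (x n)).toLp _ = _
  congr 1
  ext α
  exact inner_coherentVec_basis x α n

theorem hilbertBasis_ext_inner {ι : Type*} (x : HilbertBasis ι ℂ H) {v w : H}
    (h : ∀ m, ⟪x m, v⟫_ℂ = ⟪x m, w⟫_ℂ) : v = w := by
  refine x.repr.injective ?_
  ext m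
  rw [x.repr_apply_apply, x.repr_apply_apply, h]

/-- The Bargmann transform is a multiple of an isometry. -/
theorem inner_bargmannTransform (x : HilbertBasis ℕ ℂ H) (ξ η : H) :
    ⟪bargmannTransform x ξ, bargmannTransform x η⟫_ℂ = Real.pi * ⟪ξ, η⟫_ℂ := by
  -- Both sides are bounded, so comparing them on basis vectors suffices; there the claim is the
  -- orthogonality relation `inner_fock`.
  have h : ContinuousLinearMap.adjoint (bargmannTransform x) ∘L bargmannTransform x =
      (Real.pi : ℂ) • ContinuousLinearMap.id ℂ H := by
    refine ContinuousLinearMap.ext_on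
      (Submodule.dense_iff_topologicalClosure_eq_top.mpr x.dense_span) ?_
    rintro _ ⟨n, rfl⟩
    refine hilbertBasis_ext_inner x fun m => ?_
    rw [ContinuousLinearMap.comp_apply, ContinuousLinearMap.adjoint_inner_right,
      bargmannTransform_basis, bargmannTransform_basis, inner_fock, _root_.smul_apply,
      ContinuousLinearMap.id_apply, inner_smul_right, orthonormal_iff_ite.mp x.orthonormal]
    split_ifs <;> simp
  rw [← ContinuousLinearMap.adjoint_inner_right, ← ContinuousLinearMap.comp_apply, h,
    _root_.smul_apply, ContinuousLinearMap.id_apply, inner_smul_right]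

theorem integral_inner_coherentVec_mul (x : HilbertBasis ℕ ℂ H) (ξ η : H) :
    ∫ α : ℂ, ⟪ξ, coherentVec x α⟫_ℂ * ⟪coherentVec x α, η⟫_ℂ = Real.pi * ⟪ξ, η⟫_ℂ := by
  rw [← inner_bargmannTransform x, L2.inner_def]
  refine integral_congr_ae ?_
  filter_upwards [bargmannTransform_coeFn x ξ, bargmannTransform_coeFn x η] with α h1 h2
  rw [h1, h2, RCLike.inner_apply, inner_conj_symm, mul_comm]

/-- Totality of the coherent vectors: the resolution of the identity at ξ = η expresses `‖η‖²`
through these inner products. -/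
theorem eq_zero_of_inner_coherentVec (x : HilbertBasis ℕ ℂ H) {η : H}
    (h : ∀ α, ⟪coherentVec x α, η⟫_ℂ = 0) : η = 0 := by
  have h1 := integral_inner_coherentVec_mul x η η
  simp_rw [h, mul_zero, integral_zero] at h1
  simpa [Real.pi_ne_zero] using h1.symm

theorem inner_bargmann_husimi (x : HilbertBasis ℕ ℂ H) (A : H →L[ℂ] H) (ξ η : H) :
    ⟪ξ, bargmann x (husimi x A) η⟫_ℂ = (Real.pi : ℂ)⁻¹ *
      ∫ α : ℂ, husimiFun x A α * (⟪ξ, coherentVec x α⟫_ℂ * ⟪coherentVec x α, η⟫_ℂ) := by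
  change ⟪ξ, bargmannOp x (husimi x A) η⟫_ℂ = _
  rw [inner_bargmannOp]
  congr 1
  refine integral_congr_ae ?_
  filter_upwards [(memLp_husimiFun x A).coeFn_toLp] with α h
  change (memLp_husimiFun x A).toLp _ α * _ = _
  rw [h]

theorem integrable_husimiFun_mul (x : HilbertBasis ℕ ℂ H) (A : H →L[ℂ] H) (ξ η : H) :
    Integrable (fun α => husimiFun x A α *
      (⟪ξ, coherentVec x α⟫_ℂ * ⟪coherentVec x α, η⟫_ℂ)) (volume : Measure ℂ) := by
  refine (integrable_bargmann x (husimi x A) ξ η).congr ?_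
  filter_upwards [(memLp_husimiFun x A).coeFn_toLp] with α h
  change (memLp_husimiFun x A).toLp _ α * _ = _
  rw [h]

theorem bargmann_husimi_one (x : HilbertBasis ℕ ℂ H) : bargmann x (husimi x 1) = 1 := by
  ext η
  refine ext_inner_left ℂ fun ξ => ?_
  rw [inner_bargmann_husimi]
  have h : ∀ α, husimiFun x (1 : H →L[ℂ] H) α = 1 := fun α => by
    rw [husimiFun, one_apply_eq_self, inner_self_eq_norm_sq_to_K, norm_coherentVec]
    simp
  simp_rw [h, one_mul]
  rw [integral_inner_coherentVec_mul, one_apply_eq_self,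
    inv_mul_cancel_left₀ (by exact_mod_cast Real.pi_ne_zero)]

end BargmannTransform

/-! ### Injectivity: Fourier inversion and analytic continuation. -/

section Injectivity

open scoped FourierTransform

variable {H : Type u} [NormedAddCommGroup H] [InnerProductSpace ℂ H] [CompleteSpace H]

/-- The expansion of the overlap in the basis is an exponential series. This closed form turns
coherent matrix elements into Fourier integrals. -/
theorem inner_coherentVec_coherentVec (x : HilbertBasis ℕ ℂ H) (α β : ℂ) :
    ⟪coherentVec x α, coherentVec x β⟫_ℂ =
      Complex.exp (-‖α‖ ^ 2 / 2 - ‖β‖ ^ 2 / 2 + (starRingEnd ℂ) α * β) := by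
  refine (hasSum_inner_coherentVec x α (coherentVec x β)).unique ?_
  have h := (NormedSpace.expSeries_div_hasSum_exp ((starRingEnd ℂ) α * β)).mul_left
    (((Real.exp (-‖α‖ ^ 2 / 2) : ℝ) : ℂ) * ((Real.exp (-‖β‖ ^ 2 / 2) : ℝ) : ℂ))
  convert! h using 1
  · ext n
    rw [← inner_conj_symm, inner_coherentVec_basis, fockFun, fockFun, cohCoeff, cohCoeff]
    have hs : (((√(n.factorial : ℝ) : ℝ) : ℂ)) ^ 2 = (n.factorial : ℂ) := by
      rw [← Complex.ofReal_pow, Real.sq_sqrt (by positivity)]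
      simp
    have hs0 : (((√(n.factorial : ℝ) : ℝ) : ℂ)) ≠ 0 := by
      intro h0
      rw [h0] at hs
      have : (n.factorial : ℂ) ≠ 0 := by exact_mod_cast n.factorial_ne_zero
      exact this (by rw [← hs]; simp)
    rw [← hs]
    simp only [map_mul, map_div₀, map_pow, Complex.conj_conj, Complex.conj_ofReal]
    field_simp
    ring
  · rw [← Complex.exp_eq_exp_ℂ, Complex.ofReal_exp, Complex.ofReal_exp, ← Complex.exp_add,
      ← Complex.exp_add]
    push_cast
    ring_nf

theorem continuous_husimiFun (x : HilbertBasis ℕ ℂ H) (A : H →L[ℂ] H) :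
    Continuous (husimiFun x A) :=
  (continuous_coherentVec x).inner (A.continuous.comp (continuous_coherentVec x))

/-- A continuous integrable function with vanishing Fourier transform is zero. -/
theorem eq_zero_of_fourier_eq_zero {V E : Type*} [NormedAddCommGroup V] [InnerProductSpace ℝ V]
    [MeasurableSpace V] [BorelSpace V] [FiniteDimensional ℝ V] [NormedAddCommGroup E]
    [NormedSpace ℂ E] [CompleteSpace E] {f : V → E} (hc : Continuous f) (hi : Integrable f)
    (h : 𝓕 f = 0) : f = 0 := by
  have h1 := hc.fourierInv_fourier_eq hi (by rw [h]; exact integrable_zero _ _ _)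
  rw [← h1, h]
  ext v
  simp [Real.fourierInv_eq]

/-- The Bargmann channel is injective on the range of the Husimi map. -/
theorem husimiFun_eq_zero (x : HilbertBasis ℕ ℂ H) {A : H →L[ℂ] H}
    (hA : bargmann x (husimi x A) = 0) (α : ℂ) : husimiFun x A α = 0 := by
  set g : ℂ → ℂ := fun α => husimiFun x A α *
    (⟪coherentVec x 0, coherentVec x α⟫_ℂ * ⟪coherentVec x α, coherentVec x 0⟫_ℂ) with hg
  have hgc : Continuous g :=
    (continuous_husimiFun x A).mul ((continuous_const.inner (continuous_coherentVec x)).mul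
      ((continuous_coherentVec x).inner continuous_const))
  have h0 : 𝓕 g = 0 := by
    ext w
    rw [Real.fourier_eq']
    -- With this c, the product of the overlaps of ψ_β with ψ_{-c} and ψ_c has exponent `-‖c‖² -
    -- ‖β‖² - 2πi Re(β̄ w)`: a constant, the Gaussian in g, and the Fourier character at w.
    set c : ℂ := -(Complex.I * Real.pi * w) with hcdef
    have h1 := inner_bargmann_husimi x A (coherentVec x (-c)) (coherentVec x c)
    rw [hA, _root_.zero_apply, inner_zero_right, zero_eq_mul] at h1
    replace h1 := h1.resolve_left (inv_ne_zero (by exact_mod_cast Real.pi_ne_zero))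
    have h2 : ∀ β : ℂ, husimiFun x A β * (⟪coherentVec x (-c), coherentVec x β⟫_ℂ *
        ⟪coherentVec x β, coherentVec x c⟫_ℂ) = Complex.exp (-‖c‖ ^ 2) *
          (Complex.exp ((-2 * Real.pi * inner ℝ β w : ℝ) * Complex.I) • g β) := by
      intro β
      simp only [hg, smul_eq_mul]
      suffices h : ⟪coherentVec x (-c), coherentVec x β⟫_ℂ * ⟪coherentVec x β, coherentVec x c⟫_ℂ =
          Complex.exp (-‖c‖ ^ 2) *
            (Complex.exp ((-2 * Real.pi * inner ℝ β w : ℝ) * Complex.I) *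
              (⟪coherentVec x 0, coherentVec x β⟫_ℂ * ⟪coherentVec x β, coherentVec x 0⟫_ℂ)) by
        linear_combination husimiFun x A β * h
      simp only [inner_coherentVec_coherentVec]
      simp only [← Complex.exp_add]
      congr 1
      have h3 : (inner ℝ β w : ℝ) = ((starRingEnd ℂ) β * w).re := by
        rw [Complex.inner, mul_comm]
      have h4 : (((starRingEnd ℂ) β * w).re : ℂ) =
          ((starRingEnd ℂ) β * w + β * (starRingEnd ℂ) w) / 2 := by
        rw [Complex.re_eq_add_conj]
        simp
      have h5 : (starRingEnd ℂ) c = Complex.I * Real.pi * (starRingEnd ℂ) w := by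
        simp [hcdef]
      rw [h3]
      push_cast
      rw [h4, norm_neg, norm_zero, map_neg, h5, hcdef]
      simp only [map_zero]
      push_cast
      ring
    simp_rw [h2] at h1
    rw [integral_const_mul] at h1
    exact (mul_eq_zero.mp h1).resolve_left (Complex.exp_ne_zero _)
  have h6 := congrFun (eq_zero_of_fourier_eq_zero hgc
    (integrable_husimiFun_mul x A _ _) h0) α
  simp only [hg, inner_coherentVec_coherentVec, Pi.zero_apply, mul_eq_zero,
    Complex.exp_ne_zero, or_false] at h6
  exact h6

/-- The series converges uniformly on balls. The target is a general Banach space because the lemma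
serves both for vectors of H and for functionals on H. -/
theorem differentiable_tsum_cohCoeff {E : Type*} [NormedAddCommGroup E] [NormedSpace ℂ E]
    [CompleteSpace E] {v : ℕ → E} (hv : ∀ n, ‖v n‖ ≤ 1) :
    Differentiable ℂ fun γ : ℂ => ∑' n, cohCoeff γ n • v n := by
  intro γ
  have h : DifferentiableOn ℂ (fun γ : ℂ => ∑' n, cohCoeff γ n • v n)
      (Metric.ball 0 (‖γ‖ + 1)) := by
    refine Complex.differentiableOn_tsum_of_summable_norm (summable_bound (‖γ‖ + 1)) (fun n => ?_)
      Metric.isOpen_ball fun n β hβ => ?_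
    · unfold cohCoeff
      fun_prop
    · rw [norm_smul]
      exact (mul_le_of_le_one_right (norm_nonneg _) (hv n)).trans
        (norm_cohCoeff_le (mem_ball_zero_iff.mp hβ).le n)
  exact h.differentiableAt (Metric.isOpen_ball.mem_nhds (by simp))

/-- An entire function vanishing on the real line is zero. -/
theorem eq_zero_of_differentiable_of_real {f : ℂ → ℂ} (hf : Differentiable ℂ f)
    (h : ∀ t : ℝ, f t = 0) (z : ℂ) : f z = 0 := by
  have h1 : AnalyticOnNhd ℂ f Set.univ := fun w _ => hf.analyticAt w
  refine h1.eqOn_zero_of_preconnected_of_frequently_eq_zero isPreconnected_univ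
    (Set.mem_univ 0) ?_ (Set.mem_univ z)
  have h2 : Filter.Tendsto (fun t : ℝ => (t : ℂ)) (nhdsWithin 0 {0}ᶜ) (nhdsWithin 0 {0}ᶜ) := by
    refine tendsto_nhdsWithin_iff.mpr ⟨?_, ?_⟩
    · exact (Complex.continuous_ofReal.tendsto' 0 0 Complex.ofReal_zero).mono_left
        nhdsWithin_le_nhds
    · filter_upwards [self_mem_nhdsWithin] with t ht
      simpa using ht
  exact h2.frequently (Filter.Frequently.of_forall h)

/-- An operator is determined by its diagonal coherent state matrix elements. -/
theorem eq_zero_of_husimiFun_eq_zero (x : HilbertBasis ℕ ℂ H) {A : H →L[ℂ] H}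
    (hA : ∀ α, husimiFun x A α = 0) : A = 0 := by
  set e : ℂ → H := fun γ => ∑' n, cohCoeff γ n • x n with he
  -- Since `⟪e γ, ·⟫` is antiholomorphic in γ, the bra is reparametrized by the conjugate variable
  -- to become holomorphic.
  set e' : ℂ → H →L[ℂ] ℂ := fun γ => ∑' n, cohCoeff γ n • innerSL ℂ (x n) with he'
  have hed : Differentiable ℂ e := differentiable_tsum_cohCoeff fun n => (norm_basis x n).le
  have hv' : ∀ n, ‖innerSL ℂ (x n)‖ ≤ 1 := fun n => by rw [innerSL_apply_norm, norm_basis]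
  have hed' : Differentiable ℂ e' := differentiable_tsum_cohCoeff hv'
  have he'e : ∀ γ η, e' ((starRingEnd ℂ) γ) η = ⟪e γ, η⟫_ℂ := by
    intro γ η
    have hs : Summable fun n => cohCoeff ((starRingEnd ℂ) γ) n • innerSL ℂ (x n) := by
      refine Summable.of_norm_bounded (summable_bound ‖(starRingEnd ℂ) γ‖) fun n => ?_
      rw [norm_smul]
      exact (mul_le_of_le_one_right (norm_nonneg _) (hv' n)).trans (norm_cohCoeff_le le_rfl n)
    have h1 := hs.hasSum.mapL (ContinuousLinearMap.apply ℂ ℂ η)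
    have h2 := ((summable_cohCoeff x γ).hasSum.mapL (innerSL ℂ η)).map (starRingEnd ℂ)
      Complex.continuous_conj
    simp only [innerSL_apply_apply, inner_conj_symm] at h2
    refine h1.unique ?_
    convert! h2 using 1
    ext n
    simp only [ContinuousLinearMap.apply_apply, Function.comp, inner_conj_symm, inner_smul_left,
      _root_.smul_apply, innerSL_apply_apply, cohCoeff, map_div₀, map_pow, Complex.conj_ofReal,
      smul_eq_mul]
  have hdiag : ∀ γ, e' ((starRingEnd ℂ) γ) (A (e γ)) = 0 := by
    intro γ
    have h1 := hA γ
    rw [husimiFun, coherentVec, map_smul, inner_smul_left, inner_smul_right, mul_eq_zero,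
      mul_eq_zero] at h1
    have hne : ((Real.exp (-‖γ‖ ^ 2 / 2) : ℝ) : ℂ) ≠ 0 := by
      exact_mod_cast (Real.exp_pos _).ne'
    rw [he'e]
    simpa [hne] using h1
  -- For real s and t the two arguments are conjugate to each other, so the diagonal hypothesis
  -- applies. The identity theorem then frees s, and afterwards t.
  have h1 : ∀ (t : ℝ) (s : ℂ), e' (s - t * Complex.I) (A (e (s + t * Complex.I))) = 0 := by
    intro t
    refine eq_zero_of_differentiable_of_real ?_ fun s => ?_
    · exact (hed'.comp (by fun_prop)).clm_apply (A.differentiable.comp (hed.comp (by fun_prop)))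
    · have := hdiag (s + t * Complex.I)
      simpa [sub_eq_add_neg] using this
  have h2 : ∀ (s t : ℂ), e' (s - t * Complex.I) (A (e (s + t * Complex.I))) = 0 := by
    intro s
    refine eq_zero_of_differentiable_of_real ?_ fun t => h1 t s
    exact (hed'.comp (by fun_prop)).clm_apply (A.differentiable.comp (hed.comp (by fun_prop)))
  have h3 : ∀ β γ : ℂ, ⟪e β, A (e γ)⟫_ℂ = 0 := by
    intro β γ
    -- These values solve `s - t i = β̄` and `s + t i = γ`.
    have h4 := h2 (((starRingEnd ℂ) β + γ) / 2) (((starRingEnd ℂ) β - γ) / 2 * Complex.I)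
    have h5 : ((starRingEnd ℂ) β - γ) / 2 * Complex.I * Complex.I =
      -(((starRingEnd ℂ) β - γ) / 2) := by rw [mul_assoc, Complex.I_mul_I, mul_neg_one]
    rw [h5] at h4
    ring_nf at h4
    rw [← he'e]
    exact h4
  have h4 : ∀ γ, A (coherentVec x γ) = 0 := fun γ => by
    refine eq_zero_of_inner_coherentVec x fun β => ?_
    rw [coherentVec, coherentVec, map_smul, inner_smul_left, inner_smul_right]
    have := h3 β γ
    simp only [he] at this
    rw [this, mul_zero, mul_zero]
  -- A kills a total family, so its adjoint has range orthogonal to that family.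
  rw [← ContinuousLinearMap.adjoint.map_eq_zero_iff]
  ext η
  refine eq_zero_of_inner_coherentVec x fun γ => ?_
  rw [ContinuousLinearMap.adjoint_inner_right, h4, inner_zero_left]

theorem injective_coherentChannel (x : HilbertBasis ℕ ℂ H) (M : VonNeumannAlgebra H) :
    Function.Injective (coherentChannel x M) := by
  refine (injective_iff_map_eq_zero _).mpr fun a ha => Subtype.ext ?_
  exact eq_zero_of_husimiFun_eq_zero x (husimiFun_eq_zero x ha)

end Injectivity

/-! ### Complete positivity, tested by quadratic forms of operator matrices. -/

section CompletePositivity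

open scoped PosPart

theorem exists_eq_star_mul_self_of_nonneg {A : Type*} [NonUnitalCStarAlgebra A] [PartialOrder A]
    [StarOrderedRing A] {a : A} (ha : 0 ≤ a) : ∃ s, a = star s * s :=
  CStarAlgebra.nonneg_iff_eq_star_mul_self.mp ha

/-- A self-adjoint element whose compression to its negative part vanishes is nonnegative. -/
theorem nonneg_of_compression {A : Type*} [NonUnitalCStarAlgebra A] [PartialOrder A]
    [StarOrderedRing A] {a : A} (ha : IsSelfAdjoint a)
    (h : ∀ q : A, 0 ≤ q → star q * (a * q) = -(star q * (q * q)) → star q * (q * q) = 0) :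
    0 ≤ a := by
  have hQ : 0 ≤ a⁻ := CFC.negPart_nonneg a
  have hQs : star a⁻ = a⁻ := (IsSelfAdjoint.of_nonneg hQ).star_eq
  have h1 : a * a⁻ = -(a⁻ * a⁻) := by
    conv_lhs =>
      enter [1]
      rw [← CFC.posPart_sub_negPart a ha]
    rw [sub_mul, CFC.posPart_mul_negPart, zero_sub]
  have h2 : star a⁻ * (a⁻ * a⁻) = 0 := h _ hQ (by rw [h1, mul_neg])
  -- The cube of the negative part vanishes, hence so does its fourth power; the C⋆-identity,
  -- applied twice, then kills the negative part itself.
  have h5 : star (a⁻ * a⁻) * (a⁻ * a⁻) = 0 := by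
    rw [star_mul, mul_assoc, h2, mul_zero]
  have h7 := (CStarRing.star_mul_self_eq_zero_iff (a⁻ * a⁻)).mp h5
  nth_rewrite 1 [← hQs] at h7
  exact (CFC.negPart_eq_zero_iff a ha).mp ((CStarRing.star_mul_self_eq_zero_iff _).mp h7)

variable {H : Type u} [NormedAddCommGroup H] [InnerProductSpace ℂ H]

/-- The operator on `H ⊕ ⋯ ⊕ H` given by a matrix of operators on `H`. -/
def matrixOp {n : Type*} [Fintype n] (N : CStarMatrix n n (H →L[ℂ] H)) :
    PiLp 2 (fun _ : n => H) →ₗ[ℂ] PiLp 2 (fun _ : n => H) where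
  toFun h := WithLp.toLp 2 fun i => ∑ j, N i j (h j)
  map_add' h k := by
    ext i
    simp [Finset.sum_add_distrib]
  map_smul' c h := by
    ext i
    simp [Finset.smul_sum]

theorem matrixOp_apply {n : Type*} [Fintype n] (N : CStarMatrix n n (H →L[ℂ] H))
    (h : PiLp 2 (fun _ : n => H)) (i : n) : matrixOp N h i = ∑ j, N i j (h j) := rfl

theorem inner_matrixOp {n : Type*} [Fintype n] (N : CStarMatrix n n (H →L[ℂ] H))
    (h k : PiLp 2 (fun _ : n => H)) :
    ⟪h, matrixOp N k⟫_ℂ = ∑ i, ∑ j, ⟪h i, N i j (k j)⟫_ℂ := by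
  simp [PiLp.inner_apply, matrixOp_apply, inner_sum]

theorem matrixOp_mul {n : Type*} [Fintype n] (N M : CStarMatrix n n (H →L[ℂ] H))
    (h : PiLp 2 (fun _ : n => H)) : matrixOp (N * M) h = matrixOp N (matrixOp M h) := by
  ext i
  simp only [matrixOp_apply, CStarMatrix.mul_apply, map_sum, _root_.sum_apply,
    mul_apply_eq_comp]
  exact Finset.sum_comm

theorem matrixOp_sub {n : Type*} [Fintype n] (N M : CStarMatrix n n (H →L[ℂ] H)) :
    matrixOp (N - M) = matrixOp N - matrixOp M := by
  ext h i
  simp [matrixOp_apply]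

theorem matrixOp_neg {n : Type*} [Fintype n] (N : CStarMatrix n n (H →L[ℂ] H)) :
    matrixOp (-N) = -matrixOp N := by
  ext h i
  simp [matrixOp_apply]

theorem eq_zero_of_matrixOp {n : Type*} [Fintype n] {N : CStarMatrix n n (H →L[ℂ] H)}
    (hN : matrixOp N = 0) : N = 0 := by
  classical
  ext i j η
  have h := congrArg (fun v => v i) (LinearMap.congr_fun hN (PiLp.single 2 j η))
  simpa [matrixOp_apply, Pi.single_apply, apply_ite] using h

variable [CompleteSpace H]

theorem inner_matrixOp_star {n : Type*} [Fintype n] (N : CStarMatrix n n (H →L[ℂ] H))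
    (h k : PiLp 2 (fun _ : n => H)) : ⟪h, matrixOp (star N) k⟫_ℂ = ⟪matrixOp N h, k⟫_ℂ := by
  rw [← inner_conj_symm (matrixOp N h), inner_matrixOp, inner_matrixOp, map_sum,
    Finset.sum_comm]
  refine Finset.sum_congr rfl fun i _ => ?_
  rw [map_sum]
  refine Finset.sum_congr rfl fun j _ => ?_
  rw [inner_conj_symm, CStarMatrix.star_apply, ContinuousLinearMap.star_eq_adjoint,
    ContinuousLinearMap.adjoint_inner_right]

theorem matrixOp_nonneg {n : Type*} [Fintype n] {N : CStarMatrix n n (H →L[ℂ] H)} (hN : 0 ≤ N)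
    (h : PiLp 2 (fun _ : n => H)) : 0 ≤ ⟪h, matrixOp N h⟫_ℂ := by
  obtain ⟨S, rfl⟩ := exists_eq_star_mul_self_of_nonneg hN
  rw [matrixOp_mul, inner_matrixOp_star, inner_self_eq_norm_sq_to_K]
  positivity

/-- A matrix of operators with nonnegative quadratic form is nonnegative. -/
theorem nonneg_of_matrixOp {n : Type*} [Fintype n] {N : CStarMatrix n n (H →L[ℂ] H)}
    (hN : ∀ h : PiLp 2 (fun _ : n => H), 0 ≤ ⟪h, matrixOp N h⟫_ℂ) : 0 ≤ N := by
  classical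
  -- Complex polarization: a vanishing quadratic form forces a vanishing operator. Self-adjointness
  -- of N then follows from the reality of its form.
  have hz : ∀ M : CStarMatrix n n (H →L[ℂ] H), (∀ h, ⟪h, matrixOp M h⟫_ℂ = 0) → M = 0 := by
    intro M hM
    refine eq_zero_of_matrixOp ((inner_map_self_eq_zero _).mp fun h => ?_)
    rw [← inner_conj_symm, hM, map_zero]
  have hsa : IsSelfAdjoint N := by
    refine sub_eq_zero.mp (hz _ fun h => ?_)
    rw [matrixOp_sub, LinearMap.sub_apply, inner_sub_right, inner_matrixOp_star,
      ← inner_conj_symm (matrixOp N h), Complex.conj_eq_iff_im.mpr, sub_self]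
    exact (Complex.nonneg_iff.mp (hN h)).2.symm
  -- The form of `q N q` is nonnegative because that of N is, while that of `q³` is nonnegative
  -- because q is. As `q N q = -q³`, both vanish.
  refine nonneg_of_compression hsa fun q hq h1 => hz _ fun h => le_antisymm ?_ ?_
  · have h3 : 0 ≤ ⟪h, matrixOp (star q * (N * q)) h⟫_ℂ := by
      rw [matrixOp_mul, matrixOp_mul, inner_matrixOp_star]
      exact hN _
    rw [h1, matrixOp_neg, LinearMap.neg_apply, inner_neg_right] at h3
    exact neg_nonneg.mp h3
  · rw [matrixOp_mul, matrixOp_mul, inner_matrixOp_star]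
    exact matrixOp_nonneg hq _

theorem isChannel_coherentChannel (x : HilbertBasis ℕ ℂ H) (M : VonNeumannAlgebra H) :
    IsChannel (coherentChannel x M) := by
  refine ⟨bargmann_husimi_one x, ⟨coherentChannel x M, fun k N hN => ?_⟩, rfl⟩
  refine nonneg_of_matrixOp fun h => ?_
  obtain ⟨S, rfl⟩ := exists_eq_star_mul_self_of_nonneg hN
  set I : Fin k → Fin k → ℂ → ℂ := fun i j α =>
    husimiFun x (((star S * S) i j : M.toStarSubalgebra) : H →L[ℂ] H) α *
      (⟪h i, coherentVec x α⟫_ℂ * ⟪coherentVec x α, h j⟫_ℂ) with hI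
  have h1 : ⟪h, matrixOp ((star S * S).map (coherentChannel x M)) h⟫_ℂ =
      (Real.pi : ℂ)⁻¹ * ∫ α, ∑ i, ∑ j, I i j α := by
    rw [inner_matrixOp, integral_finsetSum _ fun i _ => integrable_finsetSum _ fun j _ =>
      integrable_husimiFun_mul x _ _ _, Finset.mul_sum]
    refine Finset.sum_congr rfl fun i _ => ?_
    rw [integral_finsetSum _ fun j _ => integrable_husimiFun_mul x _ _ _, Finset.mul_sum]
    exact Finset.sum_congr rfl fun j _ => inner_bargmann_husimi x _ _ _
  -- Pointwise positivity: inserting `(S⋆ S)ᵢⱼ = ∑ₗ Sₗᵢ⋆ Sₗⱼ` turns the integrand into a sum of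
  -- squared norms.
  have h2 : ∀ α, ∑ i, ∑ j, I i j α = ((∑ l, ‖∑ j, ⟪coherentVec x α, h j⟫_ℂ •
      (S l j : H →L[ℂ] H) (coherentVec x α)‖ ^ 2 : ℝ) : ℂ) := by
    intro α
    have h3 : ∀ i j, I i j α = ∑ l, ⟪⟪coherentVec x α, h i⟫_ℂ •
        (S l i : H →L[ℂ] H) (coherentVec x α), ⟪coherentVec x α, h j⟫_ℂ •
        (S l j : H →L[ℂ] H) (coherentVec x α)⟫_ℂ := by
      intro i j
      have h4 : (((star S * S) i j : M.toStarSubalgebra) : H →L[ℂ] H) =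
          ∑ l, star (S l i : H →L[ℂ] H) * (S l j : H →L[ℂ] H) := by
        rw [CStarMatrix.mul_apply]
        simp [CStarMatrix.star_apply]
      simp only [hI, husimiFun, h4, _root_.sum_apply, inner_sum, Finset.sum_mul]
      refine Finset.sum_congr rfl fun l _ => ?_
      rw [mul_apply_eq_comp, ContinuousLinearMap.star_eq_adjoint,
        ContinuousLinearMap.adjoint_inner_right, inner_smul_left, inner_smul_right,
        inner_conj_symm]
      ring
    simp_rw [h3]
    push_cast
    have h5 : ∀ l, (((‖∑ j, ⟪coherentVec x α, h j⟫_ℂ •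
        (S l j : H →L[ℂ] H) (coherentVec x α)‖ : ℝ) : ℂ)) ^ 2 = ∑ i, ∑ j, ⟪
        ⟪coherentVec x α, h i⟫_ℂ •
        (S l i : H →L[ℂ] H) (coherentVec x α), ⟪coherentVec x α, h j⟫_ℂ •
        (S l j : H →L[ℂ] H) (coherentVec x α)⟫_ℂ := by
      intro l
      have := inner_self_eq_norm_sq_to_K (𝕜 := ℂ) (∑ j, ⟪coherentVec x α, h j⟫_ℂ •
        (S l j : H →L[ℂ] H) (coherentVec x α))
      refine this.symm.trans ?_
      simp only [sum_inner, inner_sum]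
      exact Finset.sum_comm
    simp_rw [h5]
    exact (Finset.sum_congr rfl fun i _ => Finset.sum_comm).trans Finset.sum_comm
  change 0 ≤ ⟪h, matrixOp ((star S * S).map (coherentChannel x M)) h⟫_ℂ
  rw [h1]
  simp_rw [h2]
  rw [integral_complex_ofReal]
  refine mul_nonneg ?_ ?_
  · rw [← Complex.ofReal_inv]
    exact_mod_cast inv_nonneg.mpr Real.pi_pos.le
  · exact_mod_cast integral_nonneg fun α => Finset.sum_nonneg fun l _ => sq_nonneg _

end CompletePositivity

/-! ### Normality through a Kraus decomposition. -/

section Normality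

set_option linter.unusedSectionVars false

theorem hasSum_norm_inner_sq {ι E : Type*} [NormedAddCommGroup E] [InnerProductSpace ℂ E]
    (b : HilbertBasis ι ℂ E) (v : E) : HasSum (fun i => ‖⟪b i, v⟫_ℂ‖ ^ 2) (‖v‖ ^ 2) := by
  have h := Complex.hasSum_re (b.hasSum_inner_mul_inner v v)
  rw [← inner_self_eq_norm_sq (𝕜 := ℂ) v]
  convert! h using 1
  ext i
  rw [← inner_conj_symm v, mul_comm, Complex.mul_conj, Complex.ofReal_re,
    Complex.normSq_eq_norm_sq]

theorem continuous_sigmaWeak_tsum_of_countable {H : Type u} [NormedAddCommGroup H] [InnerProductSpace ℂ H]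
    {ι : Type*} [Countable ι] {ξ η : ι → H}
    (hξ : Summable fun i => ‖ξ i‖ ^ 2) (hη : Summable fun i => ‖η i‖ ^ 2) :
    @Continuous _ _ (sigmaWeakTopology H) _ fun X : H →L[ℂ] H => ∑' i, ⟪ξ i, X (η i)⟫_ℂ := by
  obtain ⟨f, hf⟩ := exists_injective_nat ι
  have key : ∀ {ζ : ι → H}, Summable (fun i => ‖ζ i‖ ^ 2) →
      Summable fun n => ‖Function.extend f ζ 0 n‖ ^ 2 := by
    intro ζ hζ
    refine (hf.summable_iff fun n hn => ?_).mp ?_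
    · rw [Function.extend_apply' _ _ _ hn]
      simp
    · simpa [Function.comp_def, hf.extend_apply] using hζ
  have h1 : @Continuous _ _ (sigmaWeakTopology H) _ fun X : H →L[ℂ] H =>
      ∑' n, ⟪Function.extend f ξ 0 n, X (Function.extend f η 0 n)⟫_ℂ := by
    refine continuous_iff_le_induced.mpr ?_
    exact iInf_le_of_le _ (iInf_le_of_le _ (iInf_le_of_le (key hξ) (iInf_le _ (key hη))))
  convert! h1 using 1
  ext X
  rw [← tsum_extend_zero hf]
  refine tsum_congr fun n => ?_
  by_cases hn : ∃ i, f i = n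
  · obtain ⟨i, rfl⟩ := hn
    simp only [hf.extend_apply]
  · simp [Function.extend_apply' _ _ _ hn]

/-- Square summable families have countable support, so sequences suffice. Arbitrary index sets are
allowed because the Kraus operators are indexed by a basis of `L²(ℂ)` whose countability is not
established. -/
theorem continuous_sigmaWeak_tsum {H : Type u} [NormedAddCommGroup H] [InnerProductSpace ℂ H]
    {ι : Type*} {ξ η : ι → H}
    (hξ : Summable fun i => ‖ξ i‖ ^ 2) (hη : Summable fun i => ‖η i‖ ^ 2) :
    @Continuous _ _ (sigmaWeakTopology H) _ fun X : H →L[ℂ] H => ∑' i, ⟪ξ i, X (η i)⟫_ℂ := by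
  set S := Function.support fun i => ‖ξ i‖ ^ 2 with hS
  have : Countable S := hξ.countable_support
  convert! continuous_sigmaWeak_tsum_of_countable (ι := S) (ξ := fun i => ξ i)
    (η := fun i => η i) (hξ.subtype S) (hη.subtype S) using 1
  ext X
  refine (tsum_subtype_eq_of_support_subset fun i hi => ?_).symm
  by_contra h
  have h0 : ξ i = 0 := by simpa using Function.notMem_support.mp h
  exact hi (by simp [h0])

variable {H : Type u} [NormedAddCommGroup H] [InnerProductSpace ℂ H] [CompleteSpace H]

theorem hasSum_comm_of_fiberwise {ι κ : Type*} {E : Type*} [NormedAddCommGroup E]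
    {f : ι → κ → E} {g : ι → E} {h : κ → E} {a : E}
    (hf : Summable fun p : ι × κ => f p.1 p.2) (hg : ∀ i, HasSum (f i) (g i)) (ha : HasSum g a)
    (hh : ∀ j, HasSum (fun i => f i j) (h j)) : HasSum h a := by
  have h1 := hf.hasSum
  rw [(h1.prod_fiberwise hg).unique ha] at h1
  have h2 : HasSum (fun p : κ × ι => f p.2 p.1) a := (Equiv.prodComm κ ι).hasSum_iff.mpr h1
  exact h2.prod_fiberwise hh

section DoubleSums

variable {ι κ E : Type*} [NormedAddCommGroup E] [InnerProductSpace ℂ E]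
  (b : HilbertBasis κ ℂ H) (e : HilbertBasis ι ℂ E) {v w : ι → H} {F G : H → E}

/-- The numbers `⟪b m, v j⟫` are the coefficients of one vector of `E ⊗ H`, and its squared norm can
be summed over either index first: Parseval in E for fixed m, Parseval in H for fixed j. -/
theorem hasSum_norm_sq_of_inner_eq (hv : ∀ h j, ⟪h, v j⟫_ℂ = ⟪e j, F h⟫_ℂ) {a : ℝ}
    (hF : HasSum (fun m => ‖F (b m)‖ ^ 2) a) : HasSum (fun j => ‖v j‖ ^ 2) a := by
  have h1 : ∀ m, HasSum (fun j => ‖⟪b m, v j⟫_ℂ‖ ^ 2) (‖F (b m)‖ ^ 2) := fun m => by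
    simp_rw [hv]
    exact hasSum_norm_inner_sq e _
  refine hasSum_comm_of_fiberwise (f := fun m j => ‖⟪b m, v j⟫_ℂ‖ ^ 2) ?_ h1 hF
    fun j => hasSum_norm_inner_sq b _
  refine (summable_prod_of_nonneg fun p => sq_nonneg _).mpr ⟨fun m => (h1 m).summable, ?_⟩
  simp_rw [fun m => (h1 m).tsum_eq]
  exact hF.summable

theorem summable_norm_inner_sq {ζ : ι → H} (hζ : Summable fun j => ‖ζ j‖ ^ 2) :
    Summable fun p : κ × ι => ‖⟪b p.1, ζ p.2⟫_ℂ‖ ^ 2 := by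
  have h : Summable fun p : ι × κ => ‖⟪b p.2, ζ p.1⟫_ℂ‖ ^ 2 := by
    refine (summable_prod_of_nonneg fun p => sq_nonneg _).mpr
      ⟨fun j => (hasSum_norm_inner_sq b (ζ j)).summable, ?_⟩
    exact hζ.congr fun j => ((hasSum_norm_inner_sq b (ζ j)).tsum_eq).symm
  exact h.prod_symm

theorem summable_norm_map_sq (X : H →L[ℂ] H) (hw : Summable fun j => ‖w j‖ ^ 2) :
    Summable fun j => ‖X (w j)‖ ^ 2 := by
  refine (hw.mul_left (‖X‖ ^ 2)).of_nonneg_of_le (fun _ => sq_nonneg _) fun j => ?_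
  rw [← mul_pow]
  gcongr
  exact X.le_opNorm _

theorem mul_le_sq_add_sq (a b : ℝ) : a * b ≤ a ^ 2 + b ^ 2 := by
  nlinarith [sq_nonneg (a - b), sq_nonneg (a + b)]

/-- The sesquilinear counterpart, with `1 ⊗ X` inserted: Parseval in both indices, with the double
sum dominated by square summable coefficients. -/
theorem hasSum_inner_of_inner_eq (hv : ∀ h j, ⟪h, v j⟫_ℂ = ⟪e j, F h⟫_ℂ)
    (hw : ∀ h j, ⟪h, w j⟫_ℂ = ⟪e j, G h⟫_ℂ) (hvs : Summable fun j => ‖v j‖ ^ 2)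
    (hws : Summable fun j => ‖w j‖ ^ 2) (X : H →L[ℂ] H) {a : ℂ}
    (ha : HasSum (fun m => ⟪F (b m), G (ContinuousLinearMap.adjoint X (b m))⟫_ℂ) a) :
    HasSum (fun j => ⟪v j, X (w j)⟫_ℂ) a := by
  refine hasSum_comm_of_fiberwise (f := fun m j => ⟪v j, b m⟫_ℂ * ⟪b m, X (w j)⟫_ℂ) ?_
    (fun m => ?_) ha fun j => b.hasSum_inner_mul_inner _ _
  · refine Summable.of_norm_bounded ((summable_norm_inner_sq b hvs).add
      (summable_norm_inner_sq b (summable_norm_map_sq X hws))) fun p => ?_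
    rw [norm_mul, norm_inner_symm]
    exact mul_le_sq_add_sq _ _
  · convert! e.hasSum_inner_mul_inner (F (b m)) (G (ContinuousLinearMap.adjoint X (b m)))
      using 1
    ext j
    rw [← hw, ← inner_conj_symm (F (b m)), ← hv, inner_conj_symm,
      ContinuousLinearMap.adjoint_inner_left]

end DoubleSums

theorem memLp_frameFun (x : HilbertBasis ℕ ℂ H) (h ξ : H) :
    MemLp (fun α => ⟪coherentVec x α, ξ⟫_ℂ * ⟪h, coherentVec x α⟫_ℂ) 2 (volume : Measure ℂ) := by
  refine ((memLp_inner_coherentVec x ξ).const_mul (‖h‖ : ℂ)).mono ?_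
    (Filter.Eventually.of_forall fun α => ?_)
  · exact (((continuous_coherentVec x).inner continuous_const).mul
      (continuous_const.inner (continuous_coherentVec x))).aestronglyMeasurable
  · rw [norm_mul, norm_mul, mul_comm, Complex.norm_real, norm_norm]
    refine mul_le_mul_of_nonneg_right ?_ (norm_nonneg _)
    simpa [norm_coherentVec] using norm_inner_le_norm (𝕜 := ℂ) h (coherentVec x α)

/-- The matrix element `α ↦ ⟪h, ψ_α⟫ ⟪ψ_α, ξ⟫` as an element of `L²(ℂ)`. -/
def frameFun (x : HilbertBasis ℕ ℂ H) (h ξ : H) : Lp ℂ 2 (volume : Measure ℂ) :=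
  (memLp_frameFun x h ξ).toLp _

theorem inner_frameFun (x : HilbertBasis ℕ ℂ H) (h k ξ η : H) :
    ⟪frameFun x h ξ, frameFun x k η⟫_ℂ = ∫ α : ℂ, ⟪ξ, coherentVec x α⟫_ℂ *
      ⟪coherentVec x α, η⟫_ℂ * (⟪coherentVec x α, h⟫_ℂ * ⟪k, coherentVec x α⟫_ℂ) := by
  rw [L2.inner_def]
  refine integral_congr_ae ?_
  filter_upwards [(memLp_frameFun x h ξ).coeFn_toLp, (memLp_frameFun x k η).coeFn_toLp]
    with α h1 h2
  rw [frameFun, frameFun, h1, h2, RCLike.inner_apply, map_mul, inner_conj_symm, inner_conj_symm]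
  ring

/-- Under the integral this is the Parseval expansion of `⟪ψ_α, X ψ_α⟫` in the basis x; dominated
convergence moves the sum outside. -/
theorem hasSum_inner_frameFun (x : HilbertBasis ℕ ℂ H) (X : H →L[ℂ] H) (ξ η : H) :
    HasSum (fun m => ⟪frameFun x (x m) ξ,
      frameFun x (ContinuousLinearMap.adjoint X (x m)) η⟫_ℂ)
      (∫ α : ℂ, husimiFun x X α * (⟪ξ, coherentVec x α⟫_ℂ * ⟪coherentVec x α, η⟫_ℂ)) := by
  simp_rw [inner_frameFun]
  have hψ := continuous_coherentVec x
  -- The dominating series has a sum that is at most `1 + ‖X‖²` times an integrable function of α.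
  have hsum : ∀ α, HasSum (fun m => ‖⟪ξ, coherentVec x α⟫_ℂ * ⟪coherentVec x α, η⟫_ℂ‖ *
      (‖⟪x m, coherentVec x α⟫_ℂ‖ ^ 2 + ‖⟪x m, X (coherentVec x α)⟫_ℂ‖ ^ 2))
      (‖⟪ξ, coherentVec x α⟫_ℂ * ⟪coherentVec x α, η⟫_ℂ‖ *
        (‖coherentVec x α‖ ^ 2 + ‖X (coherentVec x α)‖ ^ 2)) := fun α =>
    ((hasSum_norm_inner_sq x _).add (hasSum_norm_inner_sq x _)).mul_left _
  refine hasSum_integral_of_dominated_convergence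
    (fun m α => ‖⟪ξ, coherentVec x α⟫_ℂ * ⟪coherentVec x α, η⟫_ℂ‖ *
      (‖⟪x m, coherentVec x α⟫_ℂ‖ ^ 2 + ‖⟪x m, X (coherentVec x α)⟫_ℂ‖ ^ 2))
    (fun m => ?_) (fun m => ?_) (Filter.Eventually.of_forall fun α => (hsum α).summable) ?_ ?_
  · exact (((continuous_const.inner hψ).mul (hψ.inner continuous_const)).mul
      ((hψ.inner continuous_const).mul (continuous_const.inner hψ))).aestronglyMeasurable
  · refine Filter.Eventually.of_forall fun α => ?_
    rw [norm_mul]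
    refine mul_le_mul_of_nonneg_left ?_ (norm_nonneg _)
    rw [ContinuousLinearMap.adjoint_inner_left, norm_mul, norm_inner_symm]
    exact mul_le_sq_add_sq _ _
  · simp_rw [fun α => (hsum α).tsum_eq]
    refine ((integral_norm_mul_norm_le x ξ η).1.norm.mul_const (1 + ‖X‖ ^ 2)).mono' ?_
      (Filter.Eventually.of_forall fun α => ?_)
    · exact (((continuous_const.inner hψ).mul (hψ.inner continuous_const)).norm.mul
        ((hψ.norm.pow 2).add ((X.continuous.comp hψ).norm.pow 2))).aestronglyMeasurable
    · rw [norm_mul, norm_norm, Real.norm_of_nonneg (by positivity)]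
      refine mul_le_mul_of_nonneg_left ?_ (norm_nonneg _)
      have := X.le_opNorm (coherentVec x α)
      rw [norm_coherentVec] at *
      rw [mul_one] at this
      gcongr
      simp
  · refine Filter.Eventually.of_forall fun α => ?_
    rw [husimiFun, mul_comm (⟪coherentVec x α, X (coherentVec x α)⟫_ℂ)]
    simp_rw [ContinuousLinearMap.adjoint_inner_left]
    exact (x.hasSum_inner_mul_inner _ _).mul_left _

theorem integrable_krausVec (x : HilbertBasis ℕ ℂ H) (g : Lp ℂ 2 (volume : Measure ℂ)) (ξ : H) :
    Integrable (fun α => ((starRingEnd ℂ) (g α) * ⟪coherentVec x α, ξ⟫_ℂ) • coherentVec x α)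
      (volume : Measure ℂ) := by
  have h1 : Integrable (fun α => (starRingEnd ℂ) (g α) * ⟪coherentVec x α, ξ⟫_ℂ)
      (volume : Measure ℂ) := (Lp.memLp g).star.integrable_mul (memLp_inner_coherentVec x ξ)
  refine h1.norm.mono' (h1.1.smul (continuous_coherentVec x).aestronglyMeasurable) ?_
  exact Filter.Eventually.of_forall fun α => by rw [norm_smul, norm_coherentVec, mul_one]

/-- The vector `∫ conj (g α) ⟪ψ_α, ξ⟫ ψ_α d²α`, the value at `ξ` of a Kraus operator of the
coherent state channel. -/
def krausVec (x : HilbertBasis ℕ ℂ H) (g : Lp ℂ 2 (volume : Measure ℂ)) (ξ : H) : H :=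
  ∫ α : ℂ, ((starRingEnd ℂ) (g α) * ⟪coherentVec x α, ξ⟫_ℂ) • coherentVec x α

/-- This is the hypothesis `hv` of the double-sum lemmas, with `F h = frameFun x h ξ`. -/
theorem inner_krausVec (x : HilbertBasis ℕ ℂ H) (g : Lp ℂ 2 (volume : Measure ℂ)) (h ξ : H) :
    ⟪h, krausVec x g ξ⟫_ℂ = ⟪g, frameFun x h ξ⟫_ℂ := by
  rw [krausVec, ← integral_inner (integrable_krausVec x g ξ), L2.inner_def]
  refine integral_congr_ae ?_
  filter_upwards [(memLp_frameFun x h ξ).coeFn_toLp] with α h1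
  rw [frameFun, h1, RCLike.inner_apply, inner_smul_right]
  ring

theorem integral_husimiFun_mul (x : HilbertBasis ℕ ℂ H) (X : H →L[ℂ] H) (ξ η : H) :
    ∫ α : ℂ, husimiFun x X α * (⟪ξ, coherentVec x α⟫_ℂ * ⟪coherentVec x α, η⟫_ℂ) =
      Real.pi * ⟪ξ, bargmann x (husimi x X) η⟫_ℂ := by
  rw [inner_bargmann_husimi, mul_inv_cancel_left₀ (by exact_mod_cast Real.pi_ne_zero)]

/-- The case `X = 1`, where unitality of the channel evaluates the sum. -/
theorem hasSum_norm_frameFun_sq (x : HilbertBasis ℕ ℂ H) (ξ : H) :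
    HasSum (fun m => ‖frameFun x (x m) ξ‖ ^ 2) (Real.pi * ‖ξ‖ ^ 2) := by
  have h := Complex.hasSum_re (hasSum_inner_frameFun x 1 ξ ξ)
  rw [integral_husimiFun_mul, bargmann_husimi_one, one_apply_eq_self, Complex.re_ofReal_mul] at h
  have h1 : (⟪ξ, ξ⟫_ℂ).re = ‖ξ‖ ^ 2 := inner_self_eq_norm_sq (𝕜 := ℂ) ξ
  rw [h1] at h
  convert! h using 1
  ext m
  have h2 : ContinuousLinearMap.adjoint (1 : H →L[ℂ] H) = 1 := star_one (H →L[ℂ] H)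
  rw [h2, one_apply_eq_self]
  exact (inner_self_eq_norm_sq (𝕜 := ℂ) _).symm

theorem hasSum_norm_krausVec_sq {ι : Type*} (e : HilbertBasis ι ℂ (Lp ℂ 2 (volume : Measure ℂ)))
    (x : HilbertBasis ℕ ℂ H) (ξ : H) :
    HasSum (fun j => ‖krausVec x (e j) ξ‖ ^ 2) (Real.pi * ‖ξ‖ ^ 2) :=
  hasSum_norm_sq_of_inner_eq x e (fun h j => inner_krausVec x (e j) h ξ)
    (hasSum_norm_frameFun_sq x ξ)

/-- The Kraus decomposition of the coherent state channel. -/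
theorem hasSum_inner_krausVec {ι : Type*} (e : HilbertBasis ι ℂ (Lp ℂ 2 (volume : Measure ℂ)))
    (x : HilbertBasis ℕ ℂ H) (X : H →L[ℂ] H) (ξ η : H) :
    HasSum (fun j => ⟪krausVec x (e j) ξ, X (krausVec x (e j) η)⟫_ℂ)
      (Real.pi * ⟪ξ, bargmann x (husimi x X) η⟫_ℂ) := by
  rw [← integral_husimiFun_mul]
  exact hasSum_inner_of_inner_eq x e (fun h j => inner_krausVec x (e j) h ξ)
    (fun h j => inner_krausVec x (e j) h η) (hasSum_norm_krausVec_sq e x ξ).summable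
    (hasSum_norm_krausVec_sq e x η).summable X (hasSum_inner_frameFun x X ξ η)

theorem isNormal_coherentChannel (x : HilbertBasis ℕ ℂ H) (M : VonNeumannAlgebra H) :
    IsNormal M (coherentChannel x M) := by
  obtain ⟨s, e, -⟩ := exists_hilbertBasis ℂ (Lp ℂ 2 (volume : Measure ℂ))
  refine continuous_iInf_rng.mpr fun ξ => continuous_iInf_rng.mpr fun η =>
    continuous_iInf_rng.mpr fun hξ => continuous_iInf_rng.mpr fun hη =>
    continuous_induced_rng.mpr ?_
  have key : ∀ {ζ : ℕ → H}, Summable (fun n => ‖ζ n‖ ^ 2) →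
      Summable fun p : ℕ × s => ‖krausVec x (e p.2) (ζ p.1)‖ ^ 2 := by
    intro ζ hζ
    refine (summable_prod_of_nonneg fun p => sq_nonneg _).mpr
      ⟨fun n => (hasSum_norm_krausVec_sq e x (ζ n)).summable, ?_⟩
    exact (hζ.mul_left Real.pi).congr fun n => (hasSum_norm_krausVec_sq e x (ζ n)).tsum_eq.symm
  -- The pullback of a defining functional is again a functional of this kind, now indexed by pairs
  -- of a sequence index and a Kraus index.
  have h1 : @Continuous _ _ (sigmaWeakTopology H) _ fun X : H →L[ℂ] H => (Real.pi : ℂ)⁻¹ *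
      ∑' p : ℕ × s, ⟪krausVec x (e p.2) (ξ p.1), X (krausVec x (e p.2) (η p.1))⟫_ℂ :=
    @Continuous.comp _ _ _ (sigmaWeakTopology H) _ _ _ _ (continuous_const_mul _)
      (continuous_sigmaWeak_tsum (key hξ) (key hη))
  refine Eq.mp ?_ (@Continuous.comp M.toStarSubalgebra (H →L[ℂ] H) ℂ
    (TopologicalSpace.induced (fun X => (X : H →L[ℂ] H)) (sigmaWeakTopology H))
    (sigmaWeakTopology H) _ (fun X => (X : H →L[ℂ] H)) _ h1 continuous_induced_dom)
  congr 1
  ext X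
  have hs : Summable fun p : ℕ × s =>
      ⟪krausVec x (e p.2) (ξ p.1), (X : H →L[ℂ] H) (krausVec x (e p.2) (η p.1))⟫_ℂ := by
    refine Summable.of_norm_bounded ((key hξ).add
      (summable_norm_map_sq (X : H →L[ℂ] H) (key hη))) fun p => ?_
    exact (norm_inner_le_norm _ _).trans (mul_le_sq_add_sq _ _)
  rw [Function.comp_apply, Function.comp_apply,
    hs.tsum_prod' fun n => (hasSum_inner_krausVec e x X (ξ n) (η n)).summable, ← tsum_mul_left]
  refine tsum_congr fun n => ?_
  rw [(hasSum_inner_krausVec e x X (ξ n) (η n)).tsum_eq,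
    inv_mul_cancel_left₀ (by exact_mod_cast Real.pi_ne_zero)]
  rfl

end Normality

/-! ### Elementary tensors, slice maps and product states on the injective tensor product. -/

section InjectiveTensor

set_option linter.unusedSectionVars false

variable {H : Type u} [NormedAddCommGroup H] [InnerProductSpace ℂ H] [CompleteSpace H]
variable {K : Type v} [NormedAddCommGroup K] [InnerProductSpace ℂ K] [CompleteSpace K]

theorem continuousLinearMap_ext_vecTensor {E : Type*} [NormedAddCommGroup E] [NormedSpace ℂ E]
    {S T : HilbertTensor H K →L[ℂ] E} (h : ∀ ξ η, S (vecTensor ξ η) = T (vecTensor ξ η)) :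
    S = T := by
  ext z
  induction z using UniformSpace.Completion.induction_on with
  | hp => exact isClosed_eq S.continuous T.continuous
  | ih t =>
    induction t using TensorProduct.induction_on with
    | zero => exact (map_zero S).trans (map_zero T).symm
    | tmul ξ η => exact h ξ η
    | add t t' ht ht' =>
      rw [UniformSpace.Completion.coe_add]
      exact (map_add S _ _).trans ((congrArg₂ (· + ·) ht ht').trans (map_add T _ _).symm)

theorem vecTensor_add_right (ξ : H) (η η' : K) :
    vecTensor ξ (η + η') = vecTensor ξ η + vecTensor ξ η' := by
  refine Eq.trans ?_ (UniformSpace.Completion.coe_add (ξ ⊗ₜ[ℂ] η) (ξ ⊗ₜ[ℂ] η'))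
  rw [vecTensor, TensorProduct.tmul_add]

theorem vecTensor_smul_right (c : ℂ) (ξ : H) (η : K) :
    vecTensor ξ (c • η) = c • vecTensor ξ η := by
  refine Eq.trans ?_ (UniformSpace.Completion.coe_smul c (ξ ⊗ₜ[ℂ] η))
  rw [vecTensor, TensorProduct.tmul_smul]

theorem vecTensor_add_left (ξ ξ' : H) (η : K) :
    vecTensor (ξ + ξ') η = vecTensor ξ η + vecTensor ξ' η := by
  refine Eq.trans ?_ (UniformSpace.Completion.coe_add (ξ ⊗ₜ[ℂ] η) (ξ' ⊗ₜ[ℂ] η))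
  rw [vecTensor, TensorProduct.add_tmul]

theorem vecTensor_smul_left (c : ℂ) (ξ : H) (η : K) :
    vecTensor (c • ξ) η = c • vecTensor ξ η := by
  refine Eq.trans ?_ (UniformSpace.Completion.coe_smul c (ξ ⊗ₜ[ℂ] η))
  rw [vecTensor, TensorProduct.smul_tmul']

theorem norm_vecTensor (ξ : H) (η : K) : ‖vecTensor ξ η‖ = ‖ξ‖ * ‖η‖ :=
  (UniformSpace.Completion.norm_coe (ξ ⊗ₜ[ℂ] η)).trans (TensorProduct.norm_tmul ξ η)

theorem norm_opTensor_le (S : H →L[ℂ] H) (T : K →L[ℂ] K) : ‖opTensor S T‖ ≤ ‖S‖ * ‖T‖ := by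
  refine ContinuousLinearMap.opNorm_le_bound _ (by positivity) fun z => ?_
  induction z using UniformSpace.Completion.induction_on with
  | hp => exact isClosed_le (opTensor S T).continuous.norm (continuous_const.mul continuous_norm)
  | ih t =>
    have h1 : opTensor S T (t : UniformSpace.Completion (H ⊗[ℂ] K)) =
        ((TensorProduct.mapL S T t : H ⊗[ℂ] K) : UniformSpace.Completion (H ⊗[ℂ] K)) :=
      ContinuousLinearMap.completion_apply_coe _ t
    rw [h1]
    refine (UniformSpace.Completion.norm_coe _).le.trans ?_
    refine ((TensorProduct.mapL S T).le_opNorm t).trans ?_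
    refine mul_le_mul (TensorProduct.norm_mapL_le S T) ?_ (norm_nonneg _) (by positivity)
    exact (UniformSpace.Completion.norm_coe t).ge

theorem opTensor_mul (S S' : H →L[ℂ] H) (T T' : K →L[ℂ] K) :
    opTensor S T * opTensor S' T' = opTensor (S * S') (T * T') :=
  continuousLinearMap_ext_vecTensor fun ξ η => by
    simp only [mul_apply_eq_comp, opTensor_vecTensor]

theorem opTensor_one : opTensor (1 : H →L[ℂ] H) (1 : K →L[ℂ] K) = 1 :=
  continuousLinearMap_ext_vecTensor fun ξ η => by
    simp only [opTensor_vecTensor, one_apply_eq_self]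

theorem opTensor_add_left (S S' : H →L[ℂ] H) (T : K →L[ℂ] K) :
    opTensor (S + S') T = opTensor S T + opTensor S' T :=
  continuousLinearMap_ext_vecTensor fun ξ η => by
    simp only [opTensor_vecTensor, _root_.add_apply, vecTensor_add_left]

theorem opTensor_add_right (S : H →L[ℂ] H) (T T' : K →L[ℂ] K) :
    opTensor S (T + T') = opTensor S T + opTensor S T' :=
  continuousLinearMap_ext_vecTensor fun ξ η => by
    simp only [opTensor_vecTensor, _root_.add_apply, vecTensor_add_right]

theorem opTensor_smul_left (c : ℂ) (S : H →L[ℂ] H) (T : K →L[ℂ] K) :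
    opTensor (c • S) T = c • opTensor S T :=
  continuousLinearMap_ext_vecTensor fun ξ η => by
    simp only [opTensor_vecTensor, _root_.smul_apply, vecTensor_smul_left]

theorem opTensor_smul_right (c : ℂ) (S : H →L[ℂ] H) (T : K →L[ℂ] K) :
    opTensor S (c • T) = c • opTensor S T :=
  continuousLinearMap_ext_vecTensor fun ξ η => by
    simp only [opTensor_vecTensor, _root_.smul_apply, vecTensor_smul_right]

theorem star_opTensor (S : H →L[ℂ] H) (T : K →L[ℂ] K) :
    star (opTensor S T) = opTensor (star S) (star T) := by
  refine continuousLinearMap_ext_vecTensor fun ξ η => ?_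
  refine ext_inner_left ℂ fun z => ?_
  rw [ContinuousLinearMap.star_eq_adjoint, ContinuousLinearMap.adjoint_inner_right]
  have h : innerSL ℂ (vecTensor ξ η) ∘L opTensor S T =
      innerSL ℂ (opTensor (star S) (star T) (vecTensor ξ η)) := by
    refine continuousLinearMap_ext_vecTensor fun ξ' η' => ?_
    rw [ContinuousLinearMap.comp_apply, innerSL_apply_apply, innerSL_apply_apply,
      opTensor_vecTensor, opTensor_vecTensor, inner_vecTensor, inner_vecTensor,
      ContinuousLinearMap.star_eq_adjoint, ContinuousLinearMap.star_eq_adjoint,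
      ContinuousLinearMap.adjoint_inner_left, ContinuousLinearMap.adjoint_inner_left]
  have h2 := congrArg (starRingEnd ℂ) (DFunLike.congr_fun h z)
  rw [ContinuousLinearMap.comp_apply, innerSL_apply_apply, innerSL_apply_apply, inner_conj_symm,
    inner_conj_symm] at h2
  exact h2

variable (A : StarSubalgebra ℂ (H →L[ℂ] H)) (B : StarSubalgebra ℂ (K →L[ℂ] K))

/-- A closed subspace containing the elementary tensors contains the injective tensor product. -/
theorem mem_of_mem_injTensor {S : Submodule ℂ (HilbertTensor H K →L[ℂ] HilbertTensor H K)}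
    (hS : IsClosed (S : Set (HilbertTensor H K →L[ℂ] HilbertTensor H K)))
    (h : ∀ a ∈ A, ∀ b ∈ B, opTensor a b ∈ S)
    {T : HilbertTensor H K →L[ℂ] HilbertTensor H K} (hT : T ∈ injTensor A B) : T ∈ S := by
  set E : Set (HilbertTensor H K →L[ℂ] HilbertTensor H K) :=
    {T | ∃ a ∈ A, ∃ b ∈ B, T = opTensor a b} with hE
  rw [← SetLike.mem_coe, injTensor, StarSubalgebra.topologicalClosure_coe] at hT
  refine closure_minimal ?_ hS hT
  intro T hT
  have hT' : T ∈ Subalgebra.toSubmodule (StarAlgebra.adjoin ℂ E).toSubalgebra := hT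
  rw [StarAlgebra.adjoin_eq_span] at hT'
  -- The elementary tensors are closed under adjoints and products and contain 1, so the ⋆-algebra
  -- they generate is just their linear span.
  have hstar : E ∪ star E ⊆ E := by
    rintro T (hT | ⟨a, ha, b, hb, hT⟩)
    · exact hT
    · exact ⟨star a, star_mem ha, star b, star_mem hb, by rw [← star_opTensor, ← hT, star_star]⟩
  refine Submodule.span_le.mpr (fun T hT => ?_) hT'
  have hE : T ∈ E := by
    induction hT using Submonoid.closure_induction with
    | mem T hT => exact hstar hT
    | one => exact ⟨1, one_mem A, 1, one_mem B, opTensor_one.symm⟩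
    | mul T T' _ _ h h' =>
      obtain ⟨a, ha, b, hb, rfl⟩ := h
      obtain ⟨a', ha', b', hb', rfl⟩ := h'
      exact ⟨a * a', mul_mem ha ha', b * b', mul_mem hb hb', opTensor_mul a a' b b'⟩
  obtain ⟨a, ha, b, hb, rfl⟩ := hE
  exact h a ha b hb

/-- The operator `η ↦ ξ ⊗ η`. -/
def vecTensorL (ξ : H) : K →L[ℂ] HilbertTensor H K :=
  LinearMap.mkContinuous
    { toFun := vecTensor ξ
      map_add' := vecTensor_add_right ξ
      map_smul' := fun c η => vecTensor_smul_right c ξ η } ‖ξ‖ fun η => (norm_vecTensor ξ η).le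

theorem vecTensorL_apply (ξ : H) (η : K) : vecTensorL ξ η = vecTensor ξ η := rfl

/-- The slice map of the vector functional at `ξ`, from the operators on `H ⊗ K` to the operators
on `K`. -/
def sliceMap (ξ : H) : (HilbertTensor H K →L[ℂ] HilbertTensor H K) →L[ℂ] (K →L[ℂ] K) :=
  (ContinuousLinearMap.compL ℂ K (HilbertTensor H K) K
    (ContinuousLinearMap.adjoint (vecTensorL ξ))).comp
    ((ContinuousLinearMap.compL ℂ K (HilbertTensor H K) (HilbertTensor H K)).flip (vecTensorL ξ))

theorem sliceMap_apply (ξ : H) (T : HilbertTensor H K →L[ℂ] HilbertTensor H K) :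
    sliceMap ξ T = ContinuousLinearMap.adjoint (vecTensorL ξ) ∘L (T ∘L vecTensorL ξ) := rfl

theorem sliceMap_opTensor (ξ : H) (S : H →L[ℂ] H) (T : K →L[ℂ] K) :
    sliceMap ξ (opTensor S T) = ⟪ξ, S ξ⟫_ℂ • T := by
  ext η
  refine ext_inner_left ℂ fun ζ => ?_
  rw [sliceMap_apply, ContinuousLinearMap.comp_apply, ContinuousLinearMap.adjoint_inner_right,
    ContinuousLinearMap.comp_apply, vecTensorL_apply, vecTensorL_apply, opTensor_vecTensor,
    inner_vecTensor, _root_.smul_apply, inner_smul_right]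

/-- The slice map is a compression `V⋆ · V` with `V η = ξ ⊗ η`, so it preserves positivity. -/
theorem sliceMap_star_mul_self_nonneg (ξ : H)
    (T : HilbertTensor H K →L[ℂ] HilbertTensor H K) : 0 ≤ sliceMap ξ (star T * T) := by
  rw [ContinuousLinearMap.nonneg_iff_isPositive]
  have h : sliceMap ξ (star T * T) =
      ContinuousLinearMap.adjoint (T ∘L vecTensorL ξ) ∘L (T ∘L vecTensorL (K := K) ξ) := by
    rw [ContinuousLinearMap.adjoint_comp]
    rfl
  rw [h]
  exact ContinuousLinearMap.isPositive_adjoint_comp_self _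

/-- Elementary tensors are sliced into multiples of their right factor; closedness of B carries this
to the norm closure. This lets a state of B be composed with the slice map, so products with vector
states exist on the whole tensor product. -/
theorem sliceMap_mem (ξ : H) (hB : IsClosed (B : Set (K →L[ℂ] K)))
    {T : HilbertTensor H K →L[ℂ] HilbertTensor H K} (hT : T ∈ injTensor A B) :
    sliceMap ξ T ∈ B := by
  refine mem_of_mem_injTensor A B
    (S := (Subalgebra.toSubmodule B.toSubalgebra).comap (sliceMap ξ).toLinearMap) ?_ ?_ hT
  · exact hB.preimage (sliceMap ξ).continuous
  · intro a _ b hb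
    change sliceMap ξ (opTensor a b) ∈ B
    rw [sliceMap_opTensor]
    exact B.smul_mem hb _

/-- The vector state at `ξ` on a C⋆-algebra of operators. -/
def vectorState (ξ : H) : WeakDual ℂ A :=
  StrongDual.toWeakDual
    { toFun := fun a => ⟪ξ, (a : H →L[ℂ] H) ξ⟫_ℂ
      map_add' := fun a b => by simp
      map_smul' := fun c a => by simp
      cont := by fun_prop }

theorem vectorState_apply (ξ : H) (a : A) : vectorState A ξ a = ⟪ξ, (a : H →L[ℂ] H) ξ⟫_ℂ := rfl

theorem vectorState_mem_stateSpace {ξ : H} (hξ : ‖ξ‖ = 1) : vectorState A ξ ∈ stateSpace A := by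
  refine ⟨fun a => ?_, ?_⟩
  · rw [vectorState_apply]
    change 0 ≤ ⟪ξ, (star (a : H →L[ℂ] H) * (a : H →L[ℂ] H)) ξ⟫_ℂ
    rw [mul_apply_eq_comp, ContinuousLinearMap.star_eq_adjoint,
      ContinuousLinearMap.adjoint_inner_right, inner_self_eq_norm_sq_to_K]
    positivity
  · rw [vectorState_apply]
    change ⟪ξ, (1 : H →L[ℂ] H) ξ⟫_ℂ = 1
    rw [one_apply_eq_self, inner_self_eq_norm_sq_to_K, hξ]
    simp

/-- The slice map as a map from the injective tensor product of `A` and `B` to `B`. -/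
def sliceRestrict (ξ : H) (hB : IsClosed (B : Set (K →L[ℂ] K))) : injTensor A B →L[ℂ] B where
  toFun T := ⟨sliceMap ξ T, sliceMap_mem A B ξ hB T.2⟩
  map_add' _ _ := Subtype.ext (map_add (sliceMap ξ) _ _)
  map_smul' c T := Subtype.ext (map_smul (sliceMap ξ) c
    (T : HilbertTensor H K →L[ℂ] HilbertTensor H K))
  cont := ((sliceMap ξ).continuous.comp continuous_subtype_val).subtype_mk _

/-- The product of the vector state at `ξ` with a functional on `B`. -/
def vectorProduct (ξ : H) (hB : IsClosed (B : Set (K →L[ℂ] K))) (ψ : WeakDual ℂ B) :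
    WeakDual ℂ (injTensor A B) :=
  StrongDual.toWeakDual ((WeakDual.toStrongDual ψ).comp (sliceRestrict A B ξ hB))

theorem vectorProduct_apply (ξ : H) (hB : IsClosed (B : Set (K →L[ℂ] K))) (ψ : WeakDual ℂ B)
    (T : injTensor A B) :
    vectorProduct A B ξ hB ψ T = ψ ⟨sliceMap ξ T, sliceMap_mem A B ξ hB T.2⟩ := rfl

theorem nonneg_of_mem_stateSpace (hB : IsClosed (B : Set (K →L[ℂ] K))) {ψ : WeakDual ℂ B}
    (hψ : ψ ∈ stateSpace B) {b : B} (hb : 0 ≤ (b : K →L[ℂ] K)) : 0 ≤ ψ b := by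
  have := hB
  have hb' : 0 ≤ b := hb
  obtain ⟨s, rfl⟩ := CStarAlgebra.nonneg_iff_eq_star_mul_self.mp hb'
  exact hψ.1 s

theorem vectorProduct_elemTensor (ξ : H) (hB : IsClosed (B : Set (K →L[ℂ] K)))
    (ψ : WeakDual ℂ B) (a : A) (b : B) :
    vectorProduct A B ξ hB ψ (elemTensor A B a b) = ⟪ξ, (a : H →L[ℂ] H) ξ⟫_ℂ * ψ b := by
  rw [vectorProduct_apply, ← smul_eq_mul, ← map_smul]
  congr 1
  exact Subtype.ext (sliceMap_opTensor ξ _ _)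

theorem vectorProduct_mem_productStates {ξ : H} (hξ : ‖ξ‖ = 1)
    (hB : IsClosed (B : Set (K →L[ℂ] K))) {ψ : WeakDual ℂ B} (hψ : ψ ∈ stateSpace B) :
    vectorProduct A B ξ hB ψ ∈ productStates A B := by
  refine ⟨⟨fun T => ?_, ?_⟩, vectorState A ξ, vectorState_mem_stateSpace A hξ, ψ, hψ,
    fun a b => ?_⟩
  · rw [vectorProduct_apply]
    exact nonneg_of_mem_stateSpace B hB hψ (sliceMap_star_mul_self_nonneg ξ _)
  · rw [vectorProduct_apply, ← hψ.2]
    congr 1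
    refine Subtype.ext ?_
    change sliceMap ξ 1 = 1
    rw [← opTensor_one, sliceMap_opTensor, one_apply_eq_self, inner_self_eq_norm_sq_to_K, hξ]
    simp
  · rw [vectorProduct_elemTensor, vectorState_apply]

/-- A positive functional is bounded by twice its value at `1`. -/
theorem norm_apply_le_of_positive {A : Type*} [CStarAlgebra A] [PartialOrder A] [StarOrderedRing A]
    (f : A →ₗ[ℂ] ℂ) (hf : ∀ a, 0 ≤ f (star a * a)) (a : A) : ‖f a‖ ≤ 2 * (f 1).re * ‖a‖ := by
  have hpos : ∀ b : A, 0 ≤ b → 0 ≤ f b := by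
    intro b hb
    obtain ⟨s, rfl⟩ := CStarAlgebra.nonneg_iff_eq_star_mul_self.mp hb
    exact hf s
  have h1 : 0 ≤ f 1 := by simpa using hf 1
  -- For self-adjoint b, positivity on `‖b‖ ± b` bounds f b. Splitting a into real and imaginary
  -- parts costs the factor 2, which is harmless for compactness.
  have hsa : ∀ b : A, IsSelfAdjoint b → ‖f b‖ ≤ (f 1).re * ‖b‖ := by
    intro b hb
    have halg : algebraMap ℝ A ‖b‖ = (‖b‖ : ℂ) • (1 : A) := by
      rw [Algebra.algebraMap_eq_smul_one]
      exact (Complex.coe_smul ‖b‖ (1 : A)).symm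
    have h2 := hpos _ (sub_nonneg.mpr hb.le_algebraMap_norm_self)
    have h3 := hpos _ (sub_nonneg.mpr hb.neg_algebraMap_norm_le_self)
    rw [halg, map_sub, map_smul, smul_eq_mul] at h2
    rw [halg, sub_neg_eq_add, map_add, map_smul, smul_eq_mul] at h3
    rw [Complex.nonneg_iff] at h1 h2 h3
    have him : (f b).im = 0 := by
      have := h3.2
      simp [← h1.2] at this
      exact this.symm
    have hb2 : f b = ((f b).re : ℂ) := by
      apply Complex.ext <;> simp [him]
    rw [hb2, Complex.norm_real, Real.norm_eq_abs, abs_le]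
    have h4 := h2.1
    have h5 := h3.1
    simp at h4 h5
    constructor <;> linarith
  have h6 := realPart_add_I_smul_imaginaryPart a
  have h7 : f a = f (realPart a : A) + Complex.I * f (imaginaryPart a : A) := by
    conv_lhs => rw [← h6]
    rw [map_add, map_smul, smul_eq_mul]
  have h8 : 0 ≤ (f 1).re := (Complex.nonneg_iff.mp h1).1
  calc ‖f a‖ ≤ ‖f (realPart a : A)‖ + ‖f (imaginaryPart a : A)‖ := by
        rw [h7]
        refine (norm_add_le _ _).trans ?_
        rw [norm_mul, Complex.norm_I, one_mul]
    _ ≤ (f 1).re * ‖a‖ + (f 1).re * ‖a‖ := by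
        refine add_le_add ((hsa _ (realPart a).2).trans ?_) ((hsa _ (imaginaryPart a).2).trans ?_)
        · exact mul_le_mul_of_nonneg_left (realPart.norm_le a) h8
        · exact mul_le_mul_of_nonneg_left (imaginaryPart.norm_le a) h8
    _ = 2 * (f 1).re * ‖a‖ := by ring

instance isClosed_injTensor : IsClosed (injTensor A B : Set
    (HilbertTensor H K →L[ℂ] HilbertTensor H K)) :=
  StarSubalgebra.isClosed_topologicalClosure _

theorem norm_apply_le_of_mem_stateSpace {χ : WeakDual ℂ (injTensor A B)}
    (hχ : χ ∈ stateSpace (injTensor A B)) (T : injTensor A B) : ‖χ T‖ ≤ 2 * ‖T‖ := by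
  have h := norm_apply_le_of_positive (WeakDual.toStrongDual χ).toLinearMap hχ.1 T
  have h1 : (WeakDual.toStrongDual χ).toLinearMap 1 = 1 := hχ.2
  rw [h1] at h
  simpa using h

end InjectiveTensor

/-! ### Weak-⋆ compactness of the separable states, and partial evaluations of states. -/

section SeparableStates

set_option linter.unusedSectionVars false

variable {H : Type u} [NormedAddCommGroup H] [InnerProductSpace ℂ H] [CompleteSpace H]
variable {K : Type v} [NormedAddCommGroup K] [InnerProductSpace ℂ K] [CompleteSpace K]
variable (A : StarSubalgebra ℂ (H →L[ℂ] H)) (B : StarSubalgebra ℂ (K →L[ℂ] K))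

theorem norm_apply_le_of_mem_separableStates {χ : WeakDual ℂ (injTensor A B)}
    (hχ : χ ∈ separableStates A B) (T : injTensor A B) : ‖χ T‖ ≤ 2 * ‖T‖ := by
  have hc : IsClosed {χ : WeakDual ℂ (injTensor A B) | ‖χ T‖ ≤ 2 * ‖T‖} :=
    isClosed_le (WeakDual.eval_continuous T).norm continuous_const
  refine closure_minimal (convexHull_min (fun χ hχ => ?_) ?_) hc hχ
  · exact norm_apply_le_of_mem_stateSpace A B hχ.1 T
  · intro χ hχ χ' hχ' s t hs ht hst
    change ‖s • χ T + t • χ' T‖ ≤ 2 * ‖T‖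
    refine (norm_add_le _ _).trans ?_
    rw [norm_smul, norm_smul, Real.norm_of_nonneg hs, Real.norm_of_nonneg ht]
    calc s * ‖χ T‖ + t * ‖χ' T‖ ≤ s * (2 * ‖T‖) + t * (2 * ‖T‖) :=
          add_le_add (mul_le_mul_of_nonneg_left hχ hs) (mul_le_mul_of_nonneg_left hχ' ht)
      _ = (s + t) * (2 * ‖T‖) := by ring
      _ = 2 * ‖T‖ := by rw [hst, one_mul]

/-- Banach–Alaoglu: the set is weak-⋆ closed and lies in the ball of radius 2. -/
theorem isCompact_separableStates : IsCompact (separableStates A B) := by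
  refine (WeakDual.isCompact_closedBall (0 : StrongDual ℂ (injTensor A B)) 2).of_isClosed_subset
    isClosed_closure fun χ hχ => ?_
  refine mem_closedBall_zero_iff.mpr ?_
  exact ContinuousLinearMap.opNorm_le_bound _ (by norm_num)
    (norm_apply_le_of_mem_separableStates A B hχ)

/-- A function on elementary tensors which is pointwise approximated by separable states on finite
sets comes from a separable state. -/
theorem exists_separable_of_approx (F : A → B → ℂ)
    (h : ∀ (u : Finset (A × B)) (ε : ℝ), 0 < ε → ∃ τ ∈ separableStates A B,
      ∀ p ∈ u, ‖τ (elemTensor A B p.1 p.2) - F p.1 p.2‖ ≤ ε) :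
    ∃ τ ∈ separableStates A B, ∀ a b, τ (elemTensor A B a b) = F a b := by
  classical
  -- Finite intersection property for the closed conditions "error at most `1/(k+1)` at the pair (a,
  -- b)". Finitely many of them follow from one approximation at the smallest tolerance.
  have h1 := (isCompact_separableStates A B).inter_iInter_nonempty
    (fun q : (A × B) × ℕ => {τ : WeakDual ℂ (injTensor A B) |
      ‖τ (elemTensor A B q.1.1 q.1.2) - F q.1.1 q.1.2‖ ≤ 1 / ((q.2 : ℝ) + 1)})
    (fun q => isClosed_le ((WeakDual.eval_continuous _).sub continuous_const).norm
      continuous_const) fun u => ?_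
  · obtain ⟨τ, hτ, hτ2⟩ := h1
    refine ⟨τ, hτ, fun a b => ?_⟩
    rw [Set.mem_iInter] at hτ2
    refine sub_eq_zero.mp (norm_le_zero_iff.mp ?_)
    exact ge_of_tendsto' tendsto_one_div_add_atTop_nhds_zero_nat fun k => hτ2 ((a, b), k)
  · obtain ⟨N, hN⟩ := (u.image Prod.snd).exists_le
    obtain ⟨τ, hτ, hτ2⟩ := h (u.image Prod.fst) (1 / ((N : ℝ) + 1)) (by positivity)
    refine ⟨τ, hτ, Set.mem_iInter₂.mpr fun q hq => ?_⟩
    refine (hτ2 q.1 (Finset.mem_image_of_mem _ hq)).trans ?_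
    have : q.2 ≤ N := hN _ (Finset.mem_image_of_mem _ hq)
    gcongr

theorem norm_elemTensor_le (a : A) (b : B) : ‖elemTensor A B a b‖ ≤ ‖a‖ * ‖b‖ :=
  norm_opTensor_le _ _

theorem elemTensor_add_left (a a' : A) (b : B) :
    elemTensor A B (a + a') b = elemTensor A B a b + elemTensor A B a' b :=
  Subtype.ext (opTensor_add_left _ _ _)

theorem elemTensor_smul_left (c : ℂ) (a : A) (b : B) :
    elemTensor A B (c • a) b = c • elemTensor A B a b :=
  Subtype.ext (opTensor_smul_left _ _ _)

theorem elemTensor_add_right (a : A) (b b' : B) :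
    elemTensor A B a (b + b') = elemTensor A B a b + elemTensor A B a b' :=
  Subtype.ext (opTensor_add_right _ _ _)

theorem elemTensor_smul_right (c : ℂ) (a : A) (b : B) :
    elemTensor A B a (c • b) = c • elemTensor A B a b :=
  Subtype.ext (opTensor_smul_right _ _ _)

theorem elemTensor_one : elemTensor A B 1 1 = 1 := Subtype.ext opTensor_one

theorem elemTensor_star_mul_self (a : A) (b : B) :
    elemTensor A B (star a * a) (star b * b) = star (elemTensor A B a b) * elemTensor A B a b := by
  refine Subtype.ext ?_
  change opTensor (star (a : H →L[ℂ] H) * (a : H →L[ℂ] H))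
    (star (b : K →L[ℂ] K) * (b : K →L[ℂ] K)) =
    star (opTensor (a : H →L[ℂ] H) (b : K →L[ℂ] K)) * opTensor (a : H →L[ℂ] H) (b : K →L[ℂ] K)
  rw [star_opTensor, opTensor_mul]

/-- The elementary tensors with a fixed left factor, as a linear map of the right factor. -/
def elemTensorRight (a : A) : B →L[ℂ] injTensor A B :=
  LinearMap.mkContinuous
    { toFun := elemTensor A B a
      map_add' := elemTensor_add_right A B a
      map_smul' := fun c b => elemTensor_smul_right A B c a b } ‖a‖ (norm_elemTensor_le A B a)

/-- The partial evaluation `b ↦ ω (s⋆ s ⊗ b)` of a state `ω` is a nonnegative multiple of a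
state. -/
theorem exists_state_of_star_mul_self {ω : WeakDual ℂ (injTensor A B)}
    (hω : ω ∈ stateSpace (injTensor A B)) (hB : IsClosed (B : Set (K →L[ℂ] K))) (s : A) :
    ∃ c : ℝ, 0 ≤ c ∧ ∃ ψ ∈ stateSpace B,
      ∀ b, ω (elemTensor A B (star s * s) b) = c * ψ b := by
  have hpos : ∀ (t : A) (b : B), 0 ≤ ω (elemTensor A B (star t * t) (star b * b)) := by
    intro t b
    rw [elemTensor_star_mul_self]
    exact hω.1 _
  have h1 : 0 ≤ ω (elemTensor A B (star s * s) 1) := by simpa using hpos s 1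
  obtain ⟨c, hc, hc'⟩ : ∃ c : ℝ, 0 ≤ c ∧ ω (elemTensor A B (star s * s) 1) = c :=
    ⟨_, (Complex.nonneg_iff.mp h1).1, Complex.ext rfl (Complex.nonneg_iff.mp h1).2.symm⟩
  refine ⟨c, hc, ?_⟩
  -- If c = 0, the norm bound for positive functionals makes the whole partial evaluation vanish, so
  -- any state of B serves; `b ↦ ω(1 ⊗ b)` is one. Otherwise the functional is normalized by c.
  by_cases hc0 : c = 0
  · refine ⟨StrongDual.toWeakDual ((WeakDual.toStrongDual ω).comp (elemTensorRight A B 1)),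
      ⟨fun b => ?_, ?_⟩, fun b => ?_⟩
    · change 0 ≤ ω (elemTensor A B 1 (star b * b))
      simpa using hpos 1 b
    · change ω (elemTensor A B 1 1) = 1
      rw [elemTensor_one, hω.2]
    · have := hB
      have h2 := norm_apply_le_of_positive
        ((WeakDual.toStrongDual ω).comp (elemTensorRight A B (star s * s))).toLinearMap
        (fun b => hpos s b) b
      change ‖ω (elemTensor A B (star s * s) b)‖ ≤
        2 * (ω (elemTensor A B (star s * s) 1)).re * ‖b‖ at h2
      rw [hc', hc0] at h2
      rw [hc0, Complex.ofReal_zero, zero_mul]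
      simpa using h2
  · have hcC : (c : ℂ) ≠ 0 := by exact_mod_cast hc0
    refine ⟨StrongDual.toWeakDual ((c : ℂ)⁻¹ •
      (WeakDual.toStrongDual ω).comp (elemTensorRight A B (star s * s))),
      ⟨fun b => ?_, ?_⟩, fun b => ?_⟩
    · change 0 ≤ (c : ℂ)⁻¹ * ω (elemTensor A B (star s * s) (star b * b))
      refine mul_nonneg ?_ (hpos s b)
      rw [← Complex.ofReal_inv]
      exact_mod_cast inv_nonneg.mpr hc
    · change (c : ℂ)⁻¹ * ω (elemTensor A B (star s * s) 1) = 1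
      rw [hc', inv_mul_cancel₀ hcC]
    · change _ = (c : ℂ) * ((c : ℂ)⁻¹ * ω (elemTensor A B (star s * s) b))
      rw [mul_inv_cancel_left₀ hcC]

end SeparableStates

/-! ### Discretization of the coherent state measurement and entanglement breaking. -/

section Discretization

/-- A function with totally bounded range is uniformly approximated by its values at finitely many
points, measurably. -/
theorem exists_measurable_approx {X Y : Type*} [MeasurableSpace X] [Nonempty X]
    [PseudoMetricSpace Y] [MeasurableSpace Y] [OpensMeasurableSpace Y] {f : X → Y}
    (hf : Measurable f) (hb : TotallyBounded (Set.range f)) {δ : ℝ} (hδ : 0 < δ) :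
    ∃ (N : ℕ) (i : X → ℕ) (p : ℕ → X), Measurable i ∧ (∀ x, i x ≤ N) ∧
      ∀ x, dist (f x) (f (p (i x))) ≤ δ := by
  obtain ⟨t, htf, ht, hcov⟩ := totallyBounded_iff_subset.mp hb _ (Metric.dist_mem_uniformity hδ)
  have hne : t.Nonempty := by
    obtain ⟨x⟩ := ‹Nonempty X›
    obtain ⟨y, hy, -⟩ := Set.mem_iUnion₂.mp (hcov ⟨x, rfl⟩)
    exact ⟨y, hy⟩
  obtain ⟨e, rfl⟩ := ht.countable.exists_eq_range hne
  -- The enumeration e of the finite net may repeat values. A set of representatives is finite,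
  -- hence bounded by some N, so the indices up to N already reach the whole net.
  obtain ⟨K, -, hK⟩ := Set.exists_subset_bijOn Set.univ e
  rw [Set.image_univ] at hK
  obtain ⟨N, hN⟩ := (hK.finite_iff_finite.mpr ht).bddAbove
  have hp : ∀ k, ∃ x, f x = e k := fun k => htf ⟨k, rfl⟩
  choose p hp using hp
  refine ⟨N, fun x => SimpleFunc.nearestPtInd e N (f x), p,
    (SimpleFunc.nearestPtInd e N).measurable.comp hf,
    fun x => SimpleFunc.nearestPtInd_le e N (f x), fun x => ?_⟩
  obtain ⟨y, hy, hxy⟩ := Set.mem_iUnion₂.mp (hcov ⟨x, rfl⟩)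
  rw [← hK.image_eq] at hy
  obtain ⟨k, hk, rfl⟩ := hy
  have h := SimpleFunc.edist_nearestPt_le e (f x) (hN hk)
  rw [edist_dist, edist_dist, ENNReal.ofReal_le_ofReal_iff dist_nonneg] at h
  rw [hp, dist_comm]
  refine h.trans ?_
  rw [dist_comm]
  exact le_of_lt hxy

variable {H : Type u} [NormedAddCommGroup H] [InnerProductSpace ℂ H] [CompleteSpace H]

/-- The indicator function of a measurable set as an element of `L^∞(ℂ)`. -/
def indicatorLp (E : Set ℂ) (hE : MeasurableSet E) : Lp ℂ ∞ (volume : Measure ℂ) :=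
  ((memLp_top_const (1 : ℂ)).indicator hE).toLp _

theorem indicatorLp_coeFn {E : Set ℂ} (hE : MeasurableSet E) :
    indicatorLp E hE =ᵐ[volume] E.indicator fun _ => 1 := MemLp.coeFn_toLp _

theorem norm_bargmann_le (x : HilbertBasis ℕ ℂ H) (f : Lp ℂ ∞ (volume : Measure ℂ)) :
    ‖bargmann x f‖ ≤ ‖f‖ := by
  refine ContinuousLinearMap.opNorm_le_bound _ (norm_nonneg _) fun η => ?_
  by_cases h0 : ‖bargmann x f η‖ = 0
  · rw [h0]
    positivity
  have h1 : ‖⟪bargmann x f η, bargmann x f η⟫_ℂ‖ ≤ ‖f‖ * ‖η‖ * ‖bargmann x f η‖ := by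
    change ‖⟪bargmann x f η, bargmannOp x f η⟫_ℂ‖ ≤ _
    rw [inner_bargmannOp, norm_mul, norm_inv, Complex.norm_real,
      Real.norm_of_nonneg Real.pi_pos.le, inv_mul_le_iff₀ Real.pi_pos]
    exact (norm_integral_bargmann_le x f _ _).trans_eq (by ring)
  rw [inner_self_eq_norm_sq_to_K, norm_pow, RCLike.norm_ofReal, abs_norm, sq] at h1
  exact le_of_mul_le_mul_right h1 (lt_of_le_of_ne (norm_nonneg _) (Ne.symm h0))

theorem norm_le_of_ae_bound {f : Lp ℂ ∞ (volume : Measure ℂ)} {C : ℝ} (hC : 0 ≤ C)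
    (h : ∀ᵐ α ∂(volume : Measure ℂ), ‖f α‖ ≤ C) : ‖f‖ ≤ C := by
  rw [Lp.norm_def, eLpNorm_exponent_top]
  exact ENNReal.toReal_le_of_le_ofReal hC (eLpNormEssSup_le_of_ae_bound h)

theorem bargmann_indicatorLp_nonneg (x : HilbertBasis ℕ ℂ H) {E : Set ℂ} (hE : MeasurableSet E) :
    0 ≤ bargmann x (indicatorLp E hE) := by
  rw [ContinuousLinearMap.nonneg_iff_isPositive]
  refine ContinuousLinearMap.isPositive_iff_complex _ |>.mpr fun ξ => ?_
  have h : ⟪ξ, bargmann x (indicatorLp E hE) ξ⟫_ℂ = ((Real.pi⁻¹ *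
      ∫ α in E, ‖⟪coherentVec x α, ξ⟫_ℂ‖ ^ 2 : ℝ) : ℂ) := by
    change ⟪ξ, bargmannOp x (indicatorLp E hE) ξ⟫_ℂ = _
    rw [inner_bargmannOp, Complex.ofReal_mul, Complex.ofReal_inv, ← integral_complex_ofReal,
      ← integral_indicator hE]
    congr 1
    refine integral_congr_ae ?_
    filter_upwards [indicatorLp_coeFn hE] with α hα
    rw [hα, ← inner_conj_symm, Complex.conj_mul']
    by_cases hαE : α ∈ E <;> simp [hαE]
  have h2 : ⟪bargmann x (indicatorLp E hE) ξ, ξ⟫_ℂ = ((Real.pi⁻¹ *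
      ∫ α in E, ‖⟪coherentVec x α, ξ⟫_ℂ‖ ^ 2 : ℝ) : ℂ) := by
    rw [← inner_conj_symm, h, Complex.conj_ofReal]
  have h3 : 0 ≤ Real.pi⁻¹ * ∫ α in E, ‖⟪coherentVec x α, ξ⟫_ℂ‖ ^ 2 :=
    mul_nonneg (inv_nonneg.mpr Real.pi_pos.le) (integral_nonneg fun _ => sq_nonneg _)
  rw [h2]
  exact ⟨rfl, h3⟩

/-- Γ is a contraction from the sup norm to the operator norm, so a uniform step function
approximation of the Husimi function passes to the operators. -/
theorem norm_bargmann_husimi_sub_le (x : HilbertBasis ℕ ℂ H) (X : H →L[ℂ] H) {i : ℂ → ℕ}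
    (hi : Measurable i) {N : ℕ} (hN : ∀ α, i α ≤ N) (c : ℕ → ℂ) {δ : ℝ} (hδ : 0 ≤ δ)
    (h : ∀ α, ‖husimiFun x X α - c (i α)‖ ≤ δ) :
    ‖bargmann x (husimi x X) - ∑ n ∈ Finset.range (N + 1),
      c n • bargmann x (indicatorLp (i ⁻¹' {n}) (hi (measurableSet_singleton n)))‖ ≤ δ := by
  simp_rw [← map_smul, ← map_sum, ← map_sub]
  refine (norm_bargmann_le x _).trans (norm_le_of_ae_bound hδ ?_)
  have h1 : ∀ n, ∀ᵐ α ∂(volume : Measure ℂ),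
      (c n • indicatorLp (i ⁻¹' {n}) (hi (measurableSet_singleton n))) α =
        c n * (i ⁻¹' {n}).indicator (fun _ => 1) α := fun n => by
    filter_upwards [Lp.coeFn_smul (c n) (indicatorLp (i ⁻¹' {n}) (hi (measurableSet_singleton n))),
      indicatorLp_coeFn (hi (measurableSet_singleton n))] with α h1 h2
    rw [h1, Pi.smul_apply, h2, smul_eq_mul]
  filter_upwards [Lp.coeFn_sub (husimi x X) (∑ n ∈ Finset.range (N + 1),
      c n • indicatorLp (i ⁻¹' {n}) (hi (measurableSet_singleton n))),
    Lp.coeFn_finsetSum (Finset.range (N + 1)) fun n =>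
      c n • indicatorLp (i ⁻¹' {n}) (hi (measurableSet_singleton n)),
    ae_all_iff.mpr h1, (memLp_husimiFun x X).coeFn_toLp] with α h2 h3 h4 h5
  have h6 : (husimi x X) α = husimiFun x X α := h5
  have h7 : ∑ n ∈ Finset.range (N + 1), c n * (i ⁻¹' {n}).indicator (fun _ => (1 : ℂ)) α =
      c (i α) := by
    rw [Finset.sum_eq_single (i α)]
    · simp
    · intro n _ hn
      rw [Set.indicator_of_notMem (by simpa using hn.symm), mul_zero]
    · intro hn
      exact absurd (Finset.mem_range.mpr (Nat.lt_succ_of_le (hN α))) hn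
  rw [h2, Pi.sub_apply, h3, Finset.sum_apply, Finset.sum_congr rfl fun n _ => h4 n, h7, h6]
  exact h α

theorem norm_husimiFun_le (x : HilbertBasis ℕ ℂ H) (X : H →L[ℂ] H) (α : ℂ) :
    ‖husimiFun x X α‖ ≤ ‖X‖ := by
  refine (norm_inner_le_norm _ _).trans ?_
  rw [norm_coherentVec, one_mul]
  simpa [norm_coherentVec] using X.le_opNorm (coherentVec x α)

/-- Finitely many Husimi functions are simultaneously approximated by their values at finitely many
points. -/
theorem exists_measurable_approx_husimiFun (x : HilbertBasis ℕ ℂ H) {ι : Type*} [Fintype ι]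
    (X : ι → H →L[ℂ] H) {δ : ℝ} (hδ : 0 < δ) :
    ∃ (N : ℕ) (i : ℂ → ℕ) (p : ℕ → ℂ), Measurable i ∧ (∀ α, i α ≤ N) ∧
      ∀ α k, ‖husimiFun x (X k) α - husimiFun x (X k) (p (i α))‖ ≤ δ := by
  have hc : Continuous fun α k => husimiFun x (X k) α :=
    continuous_pi fun k => continuous_husimiFun x (X k)
  have hb : Bornology.IsBounded (Set.range fun α k => husimiFun x (X k) α) := by
    refine (Metric.isBounded_closedBall (x := (0 : ι → ℂ)) (r := ∑ k, ‖X k‖)).subset ?_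
    rintro _ ⟨α, rfl⟩
    rw [mem_closedBall_zero_iff, pi_norm_le_iff_of_nonneg (by positivity)]
    exact fun k => (norm_husimiFun_le x (X k) α).trans
      (Finset.single_le_sum (f := fun k => ‖X k‖) (fun _ _ => norm_nonneg _) (Finset.mem_univ k))
  obtain ⟨N, i, p, hi, hN, h⟩ := exists_measurable_approx hc.measurable
    (hb.isCompact_closure.totallyBounded.subset subset_closure) hδ
  refine ⟨N, i, p, hi, hN, fun α k => ?_⟩
  rw [← dist_eq_norm]
  exact (dist_le_pi_dist _ _ k).trans (h α)

variable {L : Type w} [NormedAddCommGroup L] [InnerProductSpace ℂ L] [CompleteSpace L]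
  (B : StarSubalgebra ℂ (L →L[ℂ] L))

/-- The partial evaluation `X ↦ ω (X ⊗ b)` of a functional. -/
def partialEval (ω : WeakDual ℂ (injTensor (⊤ : StarSubalgebra ℂ (H →L[ℂ] H)) B)) (b : B) :
    (H →L[ℂ] H) →ₗ[ℂ] ℂ where
  toFun X := ω (elemTensor ⊤ B ⟨X, StarSubalgebra.mem_top⟩ b)
  map_add' X Y := by
    rw [← map_add, ← elemTensor_add_left]
    rfl
  map_smul' c X := by
    rw [RingHom.id_apply, ← map_smul, ← elemTensor_smul_left]
    rfl

theorem norm_partialEval_le {ω : WeakDual ℂ (injTensor (⊤ : StarSubalgebra ℂ (H →L[ℂ] H)) B)}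
    (hω : ω ∈ stateSpace (injTensor (⊤ : StarSubalgebra ℂ (H →L[ℂ] H)) B)) (b : B)
    (X : H →L[ℂ] H) : ‖partialEval B ω b X‖ ≤ 2 * (‖X‖ * ‖b‖) :=
  (norm_apply_le_of_mem_stateSpace ⊤ B hω _).trans
    (mul_le_mul_of_nonneg_left (norm_elemTensor_le ⊤ B _ b) zero_le_two)

theorem exists_state_of_nonneg
    {ω : WeakDual ℂ (injTensor (⊤ : StarSubalgebra ℂ (H →L[ℂ] H)) B)}
    (hω : ω ∈ stateSpace (injTensor (⊤ : StarSubalgebra ℂ (H →L[ℂ] H)) B))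
    (hB : IsClosed (B : Set (L →L[ℂ] L))) {X : H →L[ℂ] H} (hX : 0 ≤ X) :
    ∃ c : ℝ, 0 ≤ c ∧ ∃ ψ ∈ stateSpace B, ∀ b, partialEval B ω b X = c * ψ b := by
  obtain ⟨s, rfl⟩ := CStarAlgebra.nonneg_iff_eq_star_mul_self.mp hX
  exact exists_state_of_star_mul_self ⊤ B hω hB ⟨s, StarSubalgebra.mem_top⟩

theorem isEntanglementBreaking_coherentChannel (x : HilbertBasis ℕ ℂ H) (M : VonNeumannAlgebra H) :
    IsEntanglementBreaking.{u, u, w} M.toStarSubalgebra (coherentChannel x M) := by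
  intro L _ _ _ B hB ω hω
  refine exists_separable_of_approx M.toStarSubalgebra B
    (fun a b => partialEval B ω b (coherentChannel x M a)) fun u ε hε => ?_
  -- R is positive and bounds every right factor in u. With the factor 2 from `norm_partialEval_le`,
  -- the tolerance `ε / (2R)` gives the error ε.
  set R : ℝ := 1 + ∑ q ∈ u, ‖q.2‖ with hR
  have hRpos : 0 < R := by positivity
  have hδ : 0 < ε / (2 * R) := by positivity
  obtain ⟨N, i, p, hi, hN, h⟩ := exists_measurable_approx_husimiFun x
    (fun q : u => (q.1.1 : H →L[ℂ] H)) hδ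
  set E : ℕ → H →L[ℂ] H := fun n =>
    bargmann x (indicatorLp (i ⁻¹' {n}) (hi (measurableSet_singleton n))) with hE
  choose c hc ψ hψ hcψ using fun n => exists_state_of_nonneg B hω hB
    (bargmann_indicatorLp_nonneg x (hi (measurableSet_singleton n)))
  set τ : WeakDual ℂ (injTensor M.toStarSubalgebra B) := ∑ n ∈ Finset.range (N + 1),
    c n • vectorProduct M.toStarSubalgebra B (coherentVec x (p n)) hB (ψ n) with hτ
  -- The Husimi function of 1 is constantly 1, so its step approximation is exact and the estimate
  -- applies with δ = 0.
  have hEone : ∑ n ∈ Finset.range (N + 1), E n = 1 := by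
    have h1 := norm_bargmann_husimi_sub_le x 1 hi hN (fun _ => 1) le_rfl fun α => by
      rw [husimiFun, one_apply_eq_self, inner_self_eq_norm_sq_to_K, norm_coherentVec]
      simp
    rw [bargmann_husimi_one] at h1
    simp only [one_smul] at h1
    exact (sub_eq_zero.mp (norm_le_zero_iff.mp h1)).symm
  -- Evaluating `ω(· ⊗ 1)` on the partition of unity makes the weights convex.
  have hcsum : ∑ n ∈ Finset.range (N + 1), c n = 1 := by
    have h1 : partialEval B ω 1 (∑ n ∈ Finset.range (N + 1), E n) = 1 := by
      rw [hEone, ← hω.2, ← elemTensor_one]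
      rfl
    rw [map_sum, Finset.sum_congr rfl fun n _ => hcψ n 1] at h1
    simp only [(hψ _).2, mul_one] at h1
    exact_mod_cast h1
  refine ⟨τ, subset_closure ?_, fun q hq => ?_⟩
  · exact (convex_convexHull ℝ _).sum_mem (fun n _ => hc n) hcsum fun n _ =>
      subset_convexHull ℝ _ (vectorProduct_mem_productStates _ _ (norm_coherentVec x _) hB (hψ n))
  -- The convex combination of product states is exactly ω applied to the discretized channel, so
  -- only the discretization error remains.
  · have h1 : τ (elemTensor M.toStarSubalgebra B q.1 q.2) = partialEval B ω q.2
        (∑ n ∈ Finset.range (N + 1), husimiFun x (q.1 : H →L[ℂ] H) (p n) • E n) := by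
      rw [map_sum, hτ]
      let ev : WeakDual ℂ (injTensor M.toStarSubalgebra B) →ₗ[ℂ] ℂ :=
        { toFun := fun χ => χ (elemTensor M.toStarSubalgebra B q.1 q.2)
          map_add' := fun _ _ => rfl
          map_smul' := fun _ _ => rfl }
      refine (map_sum ev _ _).trans (Finset.sum_congr rfl fun n _ => ?_)
      change c n • vectorProduct M.toStarSubalgebra B (coherentVec x (p n)) hB (ψ n) _ = _
      rw [map_smul, hcψ, vectorProduct_elemTensor, Complex.real_smul, smul_eq_mul, husimiFun]
      ring
    rw [h1, ← map_sub, ← norm_neg, ← map_neg, neg_sub]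
    refine (norm_partialEval_le B hω q.2 _).trans ?_
    have h2 := norm_bargmann_husimi_sub_le x (q.1 : H →L[ℂ] H) hi hN
      (fun n => husimiFun x (q.1 : H →L[ℂ] H) (p n)) hδ.le fun α => h α ⟨q, hq⟩
    have h3 : ‖q.2‖ ≤ R := by
      have := Finset.single_le_sum (f := fun q : M.toStarSubalgebra × B => ‖q.2‖)
        (fun _ _ => norm_nonneg _) hq
      rw [hR]
      linarith
    calc 2 * (_ * ‖q.2‖) ≤ 2 * (ε / (2 * R) * R) := by
          refine mul_le_mul_of_nonneg_left ?_ zero_le_two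
          exact mul_le_mul h2 h3 (norm_nonneg _) hδ.le
      _ = ε := by field_simp

end Discretization

end

end EBChannel

theorem mainTheorem3 {H : Type u} [NormedAddCommGroup H] [InnerProductSpace ℂ H] [CompleteSpace H]
    (x : HilbertBasis ℕ ℂ H) (M : VonNeumannAlgebra H) :
    EBChannel.IsChannel (EBChannel.coherentChannel x M) ∧
      EBChannel.IsNormal M (EBChannel.coherentChannel x M) ∧
      EBChannel.IsEntanglementBreaking.{u, u, w} M.toStarSubalgebra
        (EBChannel.coherentChannel x M) ∧
      Function.Injective (EBChannel.coherentChannel x M) := by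
  exact ⟨EBChannel.isChannel_coherentChannel x M, EBChannel.isNormal_coherentChannel x M,
    EBChannel.isEntanglementBreaking_coherentChannel x M,
    EBChannel.injective_coherentChannel x M⟩
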